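/- Let $n\in\mathbb N$, let $d\ge 2$ be an even integer, let $w_1,\dots,w_s\in\mathbb R[x_1,\dots,x_n]$ and let $$K=\{x\in\mathbb R^n : w_j(x)\ge 0,\ j=1,\dots,s\}.$$ Put $w_0:=1$ and $v_j:=\lceil \deg(w_j)/2\rceil$ for $j=0,\dots,s$ (with $\deg 0:=0$). For $r\ge 0$ let $\Sigma_r$ be the cone of sums of squares of real polynomials that have degree at most $2r$, and let $\Sigma_r:=\{0\}$ for $r<0$. For $k\in\mathbb N$ let $$\mathcal C_k=\Big\{\sum_{j=0}^s\sigma_jw_j : \sigma_j\in\Sigma_{k-v_j},\ j=0,\dots,s\Big\}.$$ Let $\mathbf P[x]_d$ be the set of polynomials $g$ that are homogeneous of degree $d$, nonnegative on $\mathbb R^n$, and such that $\{x\in\mathbb R^n: g(x)\le 1\}$ has finite Lebesgue volume. Let $C_d(K)$ be the cone of polynomials of degree at most $d$ that are nonnegative on $K$. Consider the optimization problems $$\mathcal P:\quad \rho=\inf\Big\{\int_{\mathbb R^n}e^{-g(x)}\,dx : g\in\mathbf P[x]_d,\ 1-g\in C_d(K)\Big\},$$ $$\mathcal P_k:\quad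 \rho_k=\inf\Big\{\int_{\mathbb R^n}e^{-g(x)}\,dx : g\in\mathbb R[x]\text{ homogeneous of degree }d,\ 1-g\in\mathcal C_k\Big\},\qquad k\in\mathbb N,$$ where the integrals take values in $[0,+\infty]$, the zero polynomial counts as homogeneous of degree $d$, and $\inf\emptyset=+\infty$. Theorem. Assume that $K$ is compact with nonempty interior, and that there are $M>0$ and $k\in\mathbb N$ with $M-\sum_{i=1}^n x_i^2\in\mathcal C_k$ (Archimedean assumption). Then $\rho<\infty$ and $\lim_{k\to\infty}\rho_k=\rho$. Moreover, $\mathcal P$ has a unique optimal solution $g^*\in\mathbf P[x]_d$, and there is $k_0\in\mathbb N$ such that for every $k\ge k_0$ the problem $\mathcal P_k$ has a unique optimal solution $g_k^*$, which belongs to $\mathbf P[x]_d$; and $g_k^*\to g^*$ as $k\to\infty$ (convergence of every coefficient). -/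

import Mathlib

open MvPolynomial MeasureTheory Filter Topology
open scoped ENNReal

noncomputable section

namespace LownerJohn

/-- The nonnegative forms of degree `d` in `n` variables whose sublevel set `{g ≤ 1}` has finite
Lebesgue volume. -/
def finiteVolumeForms (n d : ℕ) : Set (MvPolynomial (Fin n) ℝ) :=
  {g | g.IsHomogeneous d ∧ (∀ x : Fin n → ℝ, 0 ≤ eval x g) ∧
    volume {x : Fin n → ℝ | eval x g ≤ 1} < ∞}

/-- The cone of polynomials of degree at most `d` that are nonnegative on `K`. -/
def nonnegCone {n : ℕ} (d : ℕ) (K : Set (Fin n → ℝ)) : Set (MvPolynomial (Fin n) ℝ) :=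
  {f | f.totalDegree ≤ d ∧ ∀ x ∈ K, 0 ≤ eval x f}

/-- The basic closed semi-algebraic set `{x : w_j(x) ≥ 0 for all j}`. -/
def semialgebraicSet {n s : ℕ} (w : Fin s → MvPolynomial (Fin n) ℝ) : Set (Fin n → ℝ) :=
  {x | ∀ j, 0 ≤ eval x (w j)}

/-- The cone of sums of squares of polynomials, of degree at most `2 * r`. -/
def sosCone (n r : ℕ) : Set (MvPolynomial (Fin n) ℝ) :=
  {σ | IsSumSq σ ∧ σ.totalDegree ≤ 2 * r}

/-- `⌈deg p / 2⌉`. -/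
def halfDegree {n : ℕ} (p : MvPolynomial (Fin n) ℝ) : ℕ := (p.totalDegree + 1) / 2

/-- The truncated quadratic module of level `k`: all `σ₀ + ∑ j, σ j * w j`, where `σ₀` is a sum of
squares of degree at most `2 * k` and `σ j` is a sum of squares of degree at most
`2 * (k - ⌈deg (w j) / 2⌉)`. If this bound is negative then `σ j = 0`. -/
def truncatedModule {n s : ℕ} (w : Fin s → MvPolynomial (Fin n) ℝ) (k : ℕ) :
    Set (MvPolynomial (Fin n) ℝ) :=
  {f | ∃ σ₀ ∈ sosCone n k, ∃ σ : Fin s → MvPolynomial (Fin n) ℝ,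
    (∀ j, (halfDegree (w j) ≤ k ∧ σ j ∈ sosCone n (k - halfDegree (w j))) ∨ σ j = 0) ∧
    f = σ₀ + ∑ j, σ j * w j}

/-- The Archimedean assumption: some `M - ‖x‖²` (Euclidean norm) with `M > 0` lies in some
truncated quadratic module. -/
def Archimedean {n s : ℕ} (w : Fin s → MvPolynomial (Fin n) ℝ) : Prop :=
  ∃ M : ℝ, 0 < M ∧ ∃ k : ℕ,
    (C M - ∑ i, X i ^ 2 : MvPolynomial (Fin n) ℝ) ∈ truncatedModule w k

/-- The objective `∫ exp (-g(x)) dx` over `ℝⁿ`, with value `∞` if the integral diverges. -/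
def objective {n : ℕ} (g : MvPolynomial (Fin n) ℝ) : ℝ≥0∞ :=
  ∫⁻ x : Fin n → ℝ, ENNReal.ofReal (Real.exp (-(eval x g)))

/-- The feasible set of the problem `P`: the forms `g` of degree `d`, nonnegative and with
`{g ≤ 1}` of finite volume, such that `1 - g` is nonnegative on `K`. -/
def feasible {n : ℕ} (d : ℕ) (K : Set (Fin n → ℝ)) : Set (MvPolynomial (Fin n) ℝ) :=
  {g | g ∈ finiteVolumeForms n d ∧ 1 - g ∈ nonnegCone d K}

/-- The feasible set of the problem `P_k`: the forms `g` of degree `d` such that `1 - g` lies in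
the truncated quadratic module of level `k`. Neither nonnegativity nor finite volume is imposed. -/
def feasibleLevel {n s : ℕ} (d : ℕ) (w : Fin s → MvPolynomial (Fin n) ℝ) (k : ℕ) :
    Set (MvPolynomial (Fin n) ℝ) :=
  {g | g.IsHomogeneous d ∧ 1 - g ∈ truncatedModule w k}

/-- The infimum of the objective over the feasible set `S` (`∞` if `S` is empty). -/
def optimalValue {n : ℕ} (S : Set (MvPolynomial (Fin n) ℝ)) : ℝ≥0∞ := ⨅ g ∈ S, objective g

/-- `g` is the one and only minimizer of the objective over `S`. -/
def IsUniqueOptimal {n : ℕ} (S : Set (MvPolynomial (Fin n) ℝ)) (g : MvPolynomial (Fin n) ℝ) :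
    Prop :=
  (g ∈ S ∧ objective g = optimalValue S) ∧ ∀ h ∈ S, objective h = optimalValue S → h = g

end LownerJohn

end

/-! The objective is strictly convex and, by Fatou, lower semicontinuous for coefficientwise
convergence in bounded degree. A form of positive degree with finite objective is automatically
nonnegative with finite-volume sublevel set, so among forms of finite objective the constraints of
`P` reduce to `g ≤ 1` on `K`. Such forms take values in `[0, 1]` on `K`; as `K` has interior, this
confines them to a compact set. Minimizers therefore exist by the direct method and are unique by
strict convexity (`exists_isUniqueOptimal`).

For `P_k` the direct method also needs the limit of a minimizing sequence to keep its certificate.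
Finite objective gives `1 - g ≤ 1`, and this bound at finitely many points where every nonzero `w j`
is positive confines the sums-of-squares multipliers to a compact set
(`exists_isCompact_truncatedModule`).

Truncated certificates imply nonnegativity on `K`, so `ρ ≤ ρ_k`. Conversely, for `0 < t < 1` the
form `t ^ d • gstar` is strictly below `1` on `K`, hence feasible for `P_k` with `k` large by
Putinar's Positivstellensatz, and homogeneity gives it the objective `t⁻ⁿ ρ`; let `t → 1`.
Convergence of the minimizers follows from compactness and uniqueness of `gstar`.

Putinar's theorem is proved through states: an element outside an Archimedean quadratic module is
nonpositive at some extreme state, and extreme states are multiplicative, hence point evaluations.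
-/

namespace LownerJohn

/-! ### Archimedean quadratic modules, their states and characters -/

section Putinar

/-- An Archimedean quadratic module in a commutative real algebra. -/
structure IsArchimedeanModule {A : Type*} [CommRing A] [Algebra ℝ A] (Q : Set A) : Prop where
  one_mem : (1 : A) ∈ Q
  add_mem : ∀ {a b : A}, a ∈ Q → b ∈ Q → a + b ∈ Q
  sq_mul_mem : ∀ (a : A) {b : A}, b ∈ Q → a ^ 2 * b ∈ Q
  bounded : ∀ a : A, ∃ c : ℝ, algebraMap ℝ A c - a ∈ Q

variable {A : Type*} [CommRing A] [Algebra ℝ A] {Q : Set A}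

namespace IsArchimedeanModule

theorem sq_mem (hQ : IsArchimedeanModule Q) (a : A) : a ^ 2 ∈ Q := by
  simpa using hQ.sq_mul_mem a hQ.one_mem

theorem zero_mem (hQ : IsArchimedeanModule Q) : (0 : A) ∈ Q := by
  simpa using hQ.sq_mem 0

theorem smul_mem (hQ : IsArchimedeanModule Q) {c : ℝ} (hc : 0 ≤ c) {a : A} (ha : a ∈ Q) :
    c • a ∈ Q := by
  have := hQ.sq_mul_mem (algebraMap ℝ A (√c)) ha
  rwa [← map_pow, Real.sq_sqrt hc, ← Algebra.smul_def] at this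

theorem algebraMap_mem (hQ : IsArchimedeanModule Q) {c : ℝ} (hc : 0 ≤ c) :
    algebraMap ℝ A c ∈ Q := by
  simpa [Algebra.smul_def] using hQ.smul_mem hc hQ.one_mem

/-- Every element has a positive bound. -/
theorem exists_pos_bound (hQ : IsArchimedeanModule Q) (a : A) (r : ℝ) :
    ∃ c : ℝ, r < c ∧ 0 < c ∧ algebraMap ℝ A c - a ∈ Q := by
  obtain ⟨c, hc⟩ := hQ.bounded a
  refine ⟨max c (max r 0 + 1), ?_, ?_, ?_⟩
  · exact lt_max_of_lt_right (by linarith [le_max_left r 0])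
  · exact lt_max_of_lt_right (by linarith [le_max_right r 0])
  · have := hQ.add_mem hc
      (hQ.algebraMap_mem (sub_nonneg.2 (le_max_left c (max r 0 + 1))))
    rw [map_sub] at this
    convert this using 1
    ring

end IsArchimedeanModule

/-- The states of `Q`: normalized linear functionals that are nonnegative on `Q`. -/
def states (Q : Set A) : Set (A → ℝ) :=
  {φ | (∀ a b, φ (a + b) = φ a + φ b) ∧ (∀ (c : ℝ) a, φ (c • a) = c * φ a) ∧ φ 1 = 1 ∧
    ∀ q ∈ Q, 0 ≤ φ q}

theorem states_algebraMap {φ : A → ℝ} (hφ : φ ∈ states Q) (c : ℝ) : φ (algebraMap ℝ A c) = c := by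
  rw [Algebra.algebraMap_eq_smul_one, hφ.2.1, hφ.2.2.1, mul_one]

theorem states_sub {φ : A → ℝ} (hφ : φ ∈ states Q) (a b : A) : φ (a - b) = φ a - φ b := by
  have := hφ.1 (a - b) b
  rw [sub_add_cancel] at this
  linarith

theorem states_neg {φ : A → ℝ} (hφ : φ ∈ states Q) (a : A) : φ (-a) = -φ a := by
  have := hφ.2.1 (-1) a
  simpa using this

theorem isClosed_states (Q : Set A) : IsClosed (states Q) := by
  have h : states Q = (⋂ a, ⋂ b, {φ : A → ℝ | φ (a + b) = φ a + φ b}) ∩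
      ((⋂ c : ℝ, ⋂ a, {φ : A → ℝ | φ (c • a) = c * φ a}) ∩
      ({φ : A → ℝ | φ 1 = 1} ∩ ⋂ q ∈ Q, {φ : A → ℝ | 0 ≤ φ q})) := by
    ext φ
    simp [states]
  rw [h]
  refine (isClosed_iInter fun a => isClosed_iInter fun b => isClosed_eq ?_ ?_).inter
    ((isClosed_iInter fun a => isClosed_iInter fun b => isClosed_eq ?_ ?_).inter
    ((isClosed_eq ?_ ?_).inter (isClosed_biInter fun q _ => isClosed_le ?_ ?_))) <;> fun_prop

theorem isCompact_states (hQ : IsArchimedeanModule Q) : IsCompact (states Q) := by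
  choose c hc using hQ.bounded
  refine (isCompact_univ_pi (fun a : A => isCompact_Icc (a := -c (-a)) (b := c a))).of_isClosed_subset
    (isClosed_states Q) fun φ hφ a _ => ⟨?_, ?_⟩
  · have := hφ.2.2.2 _ (hc (-a))
    rw [states_sub hφ, states_algebraMap hφ, states_neg hφ] at this
    linarith
  · have := hφ.2.2.2 _ (hc a)
    rw [states_sub hφ, states_algebraMap hφ] at this
    linarith

/-- M. Riesz extension of `t • 1 ↦ t` along the cone `Q - ℝ≥0 • f`: boundedness makes `1` an order
unit, and a negative constant in the cone would force `f ∈ Q`. -/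
theorem exists_state_nonpos (hQ : IsArchimedeanModule Q) {f : A} (hf : f ∉ Q) :
    ∃ φ ∈ states Q, φ f ≤ 0 := by
  let s : PointedCone ℝ A :=
    { carrier := {x | ∃ q ∈ Q, ∃ t : ℝ, 0 ≤ t ∧ x = q - t • f}
      add_mem' := by
        rintro _ _ ⟨q, hq, t, ht, rfl⟩ ⟨q', hq', t', ht', rfl⟩
        exact ⟨q + q', hQ.add_mem hq hq', t + t', by positivity, by rw [add_smul]; abel⟩
      zero_mem' := ⟨0, hQ.zero_mem, 0, le_rfl, by simp⟩
      smul_mem' := by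
        rintro ⟨c, hc⟩ _ ⟨q, hq, t, ht, rfl⟩
        refine ⟨c • q, hQ.smul_mem hc hq, c * t, by positivity, ?_⟩
        change c • (q - t • f) = _
        rw [smul_sub, mul_smul] }
  have hQs : ∀ q ∈ Q, q ∈ s := fun q hq => ⟨q, hq, 0, le_rfl, by simp⟩
  have hneg : ∀ t : ℝ, algebraMap ℝ A t ∈ s → 0 ≤ t := by
    rintro t ⟨q, hq, u, hu, h⟩
    by_contra! ht
    apply hf
    rcases hu.eq_or_lt with rfl | hu
    -- Here the negative constant `t` lies in `Q` itself, and a multiple of it cancels the constant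
    -- in `c + f ∈ Q`.
    · obtain ⟨c, -, hc0, hc⟩ := hQ.exists_pos_bound (-f) 0
      have h1 : algebraMap ℝ A t ∈ Q := by rw [h]; simpa using hq
      have h2 := hQ.add_mem hc (hQ.smul_mem (c := c / -t) (by apply div_nonneg <;> linarith) h1)
      rw [Algebra.smul_def, ← map_mul] at h2
      have : c / -t * t = -c := by
        rw [div_neg, neg_mul, div_mul_cancel₀ _ ht.ne]
      rw [this, map_neg] at h2
      simpa using h2
    · have h1 : f = u⁻¹ • (q + algebraMap ℝ A (-t)) := by
        rw [map_neg, h, neg_sub, add_sub_cancel, smul_smul, inv_mul_cancel₀ hu.ne', one_smul]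
      rw [h1]
      exact hQ.smul_mem (by positivity) (hQ.add_mem hq (hQ.algebraMap_mem (by linarith)))
  have h10 : (1 : A) ≠ 0 := by
    intro h
    have := hneg (-1) (by simp [h])
    linarith
  let φ₀ : A →ₗ.[ℝ] ℝ := LinearPMap.mkSpanSingleton (1 : A) (1 : ℝ) h10
  obtain ⟨g, hg, hgs⟩ := riesz_extension s φ₀ (by
      rintro ⟨x, hx⟩ hxs
      obtain ⟨t, rfl⟩ := Submodule.mem_span_singleton.1 hx
      have : φ₀ ⟨t • 1, hx⟩ = t • 1 := LinearPMap.mkSpanSingleton'_apply _ _ _ _ _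
      rw [this]
      simpa using hneg t (by rw [Algebra.algebraMap_eq_smul_one]; exact hxs)) (by
      intro y
      obtain ⟨c, hc⟩ := hQ.bounded (-y)
      refine ⟨⟨c • 1, Submodule.mem_span_singleton.2 ⟨c, rfl⟩⟩, hQs _ ?_⟩
      simpa [Algebra.algebraMap_eq_smul_one] using hc)
  refine ⟨g, ⟨fun a b => map_add g a b, fun c a => by simp, ?_, fun q hq => hgs q (hQs q hq)⟩, ?_⟩
  · have h1 : (1 : A) ∈ φ₀.domain := Submodule.mem_span_singleton_self _
    have := hg ⟨1, h1⟩
    rw [show ((⟨1, h1⟩ : φ₀.domain) : A) = 1 from rfl] at this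
    rw [this]
    have h2 : φ₀ ⟨(1 : ℝ) • 1, by simpa using h1⟩ = (1 : ℝ) • (1 : ℝ) :=
      LinearPMap.mkSpanSingleton'_apply _ _ _ _ _
    simpa using h2
  · have := hgs (-f) ⟨0, hQ.zero_mem, 1, zero_le_one, by simp⟩
    simpa using this

/-- The states minimizing `φ f` form a compact extreme subset, which has an extreme point by
Krein–Milman. -/
theorem exists_extreme_state_nonpos (hQ : IsArchimedeanModule Q) {f : A} (hf : f ∉ Q) :
    ∃ φ ∈ (states Q).extremePoints ℝ, φ f ≤ 0 := by
  obtain ⟨φ₀, hφ₀, hφ₀f⟩ := exists_state_nonpos hQ hf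
  obtain ⟨ψ, hψ, hmin⟩ := (isCompact_states hQ).exists_isMinOn ⟨φ₀, hφ₀⟩
    (continuous_apply f).continuousOn
  have hmin' : ∀ φ ∈ states Q, ψ f ≤ φ f := fun φ hφ => hmin hφ
  let F : Set (A → ℝ) := states Q ∩ {φ | φ f = ψ f}
  have hF : IsCompact F := (isCompact_states hQ).inter_right
    (isClosed_eq (continuous_apply f) continuous_const)
  have hext : IsExtreme ℝ (states Q) F := by
    refine ⟨Set.inter_subset_left, ?_⟩
    rintro x hx y hy z hz ⟨a, b, ha, hb, hab, rfl⟩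
    refine ⟨hx, ?_⟩
    have h1 : a * x f + b * y f = ψ f := hz.2
    have h2 := hmin' x hx
    have h3 := hmin' y hy
    change x f = ψ f
    have hb' : b = 1 - a := by linarith
    subst hb'
    nlinarith
  obtain ⟨φ, hφ⟩ := hF.extremePoints_nonempty ⟨ψ, hψ, rfl⟩
  exact ⟨φ, hext.extremePoints_subset_extremePoints hφ, (hφ.1.2.trans_le (hmin' _ hφ₀)).trans hφ₀f⟩


theorem state_cauchy_schwarz (hQ : IsArchimedeanModule Q) {φ : A → ℝ} (hφ : φ ∈ states Q)
    {q : A} (hq : q ∈ Q) (a b : A) : φ (a * b * q) ^ 2 ≤ φ (a ^ 2 * q) * φ (b ^ 2 * q) := by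
  have h : ∀ x : ℝ, 0 ≤ φ (b ^ 2 * q) * (x * x) + 2 * φ (a * b * q) * x + φ (a ^ 2 * q) := by
    intro x
    have h1 := hφ.2.2.2 _ (hQ.sq_mul_mem (a + x • b) hq)
    have h2 : (a + x • b) ^ 2 * q =
        a ^ 2 * q + (2 * x) • (a * b * q) + (x * x) • (b ^ 2 * q) := by
      simp only [Algebra.smul_def, map_mul, map_ofNat]
      ring
    rw [h2, hφ.1, hφ.1, hφ.2.1, hφ.2.1] at h1
    linarith
  have := discrim_le_zero h
  rw [discrim] at this
  nlinarith

theorem state_pow_le (hQ : IsArchimedeanModule Q) {φ : A → ℝ} (hφ : φ ∈ states Q)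
    (q : A) {g : A} {c : ℝ} (hc : 0 ≤ c) (hg : algebraMap ℝ A c - g ^ 2 ∈ Q) :
    ∃ B : ℝ, 0 < B ∧ ∀ N : ℕ, φ ((g ^ N) ^ 2 * q) ≤ B * c ^ N := by
  obtain ⟨B, -, hB0, hB⟩ := hQ.exists_pos_bound q 0
  have h3 : ∀ N, φ ((g ^ N) ^ 2) ≤ c ^ N := by
    intro N
    induction N with
    | zero => simp [hφ.2.2.1]
    | succ N ih =>
      have h4 := hφ.2.2.2 _ (hQ.sq_mul_mem (g ^ N) hg)
      have h5 : (g ^ N) ^ 2 * (algebraMap ℝ A c - g ^ 2) = c • (g ^ N) ^ 2 - (g ^ (N + 1)) ^ 2 := by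
        rw [Algebra.smul_def]; ring
      rw [h5, states_sub hφ, hφ.2.1] at h4
      have := mul_le_mul_of_nonneg_left ih hc
      rw [pow_succ c]
      linarith
  refine ⟨B, hB0, fun N => ?_⟩
  have h1 := hφ.2.2.2 _ (hQ.sq_mul_mem (g ^ N) hB)
  have h2 : (g ^ N) ^ 2 * (algebraMap ℝ A B - q) = B • (g ^ N) ^ 2 - (g ^ N) ^ 2 * q := by
    rw [Algebra.smul_def]; ring
  rw [h2, states_sub hφ, hφ.2.1] at h1
  have := mul_le_mul_of_nonneg_left (h3 N) hB0.le
  linarith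

/-- Cauchy–Schwarz against `1`, iterated; each application doubles the exponent of `g`. -/
theorem state_pow_two_pow_le (hQ : IsArchimedeanModule Q) {φ : A → ℝ} (hφ : φ ∈ states Q)
    {q : A} (hq : q ∈ Q) (g : A) (m : ℕ) :
    φ (g ^ 2 * q) ^ 2 ^ m * φ q ≤ φ ((g ^ 2 ^ m) ^ 2 * q) * φ q ^ 2 ^ m := by
  have hq0 := hφ.2.2.2 q hq
  induction m with
  | zero => simp
  | succ m ih =>
    have h0 := hφ.2.2.2 _ (hQ.sq_mul_mem g hq)
    have hm := hφ.2.2.2 _ (hQ.sq_mul_mem (g ^ 2 ^ m) hq)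
    have hm' := hφ.2.2.2 _ (hQ.sq_mul_mem (g ^ 2 ^ (m + 1)) hq)
    have hcs := state_cauchy_schwarz hQ hφ hq ((g ^ 2 ^ m) ^ 2) 1
    have e : ((g ^ 2 ^ m) ^ 2) ^ 2 = (g ^ 2 ^ (m + 1)) ^ 2 := by ring
    rw [e, mul_one, one_pow, one_mul] at hcs
    rcases hq0.eq_or_lt with hz | hpos
    · rw [← hz]; simp
    · have h1 : (φ (g ^ 2 * q) ^ 2 ^ m * φ q) ^ 2 ≤ (φ ((g ^ 2 ^ m) ^ 2 * q) * φ q ^ 2 ^ m) ^ 2 :=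
        pow_le_pow_left₀ (by positivity) ih 2
      have h2 : (φ ((g ^ 2 ^ m) ^ 2 * q) * φ q ^ 2 ^ m) ^ 2 ≤
          (φ ((g ^ 2 ^ (m + 1)) ^ 2 * q) * φ q) * (φ q ^ 2 ^ m) ^ 2 := by
        rw [mul_pow]
        gcongr
      have h3 := h1.trans h2
      have h4 : φ (g ^ 2 * q) ^ 2 ^ (m + 1) * φ q * φ q ≤
          φ ((g ^ 2 ^ (m + 1)) ^ 2 * q) * φ q ^ 2 ^ (m + 1) * φ q := by
        calc _ = (φ (g ^ 2 * q) ^ 2 ^ m * φ q) ^ 2 := by ring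
          _ ≤ _ := h3
          _ = _ := by ring
      exact le_of_mul_le_mul_right h4 hpos

/-- `Q` need not be closed under products, so `(c - g ^ 2) * q ∈ Q` is not available. Instead, if
the bound failed, the iterated Cauchy–Schwarz inequality would make `φ ((g ^ N) ^ 2 * q)` outgrow
the bound `B * c ^ N` along `N = 2 ^ m`. -/
theorem state_sq_mul_le (hQ : IsArchimedeanModule Q) {φ : A → ℝ} (hφ : φ ∈ states Q)
    {q g : A} (hq : q ∈ Q) {c : ℝ} (hc : 0 < c) (hg : algebraMap ℝ A c - g ^ 2 ∈ Q) :
    φ (g ^ 2 * q) ≤ c * φ q := by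
  obtain ⟨B, hB0, hB⟩ := state_pow_le hQ hφ q hc.le hg
  have hq0 := hφ.2.2.2 q hq
  have h0 := hφ.2.2.2 _ (hQ.sq_mul_mem g hq)
  rcases hq0.eq_or_lt with hz | hpos
  · have hcs := state_cauchy_schwarz hQ hφ hq (g ^ 2) 1
    rw [one_pow, one_mul, ← hz, mul_zero, mul_one] at hcs
    rw [← hz, mul_zero]
    nlinarith
  · by_contra! hlt
    set r := φ (g ^ 2 * q) / (c * φ q) with hr
    have hr1 : 1 < r := (one_lt_div (by positivity)).2 hlt
    have hbd : ∀ m : ℕ, r ^ 2 ^ m ≤ B / φ q := by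
      intro m
      have h1 := state_pow_two_pow_le hQ hφ hq g m
      have h2 := h1.trans (mul_le_mul_of_nonneg_right (hB (2 ^ m)) (by positivity))
      rw [hr, div_pow, div_le_div_iff₀ (by positivity) hpos, mul_pow]
      linarith
    obtain ⟨m, hm⟩ := pow_unbounded_of_one_lt (B / φ q) hr1
    have h3 : r ^ m ≤ r ^ 2 ^ m := pow_le_pow_right₀ hr1.le Nat.lt_two_pow_self.le
    linarith [hbd m]

/-- With `c - g ^ 2 ∈ Q` and `c > φ (g ^ 2) > 0`, `φ` is a proper convex combination of the
normalizations of `φ (g ^ 2 * ·)` and `φ ((c - g ^ 2) * ·)`. Both are states, so extremality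
identifies the first with `φ`. -/
theorem extreme_state_sq_mul (hQ : IsArchimedeanModule Q) {φ : A → ℝ}
    (hφ : φ ∈ (states Q).extremePoints ℝ) (g p : A) : φ (g ^ 2 * p) = φ (g ^ 2) * φ p := by
  have hs := hφ.1
  obtain ⟨c, hc, hc0, hcQ⟩ := hQ.exists_pos_bound (g ^ 2) (φ (g ^ 2))
  have hg0 := hs.2.2.2 _ (hQ.sq_mem g)
  rcases hg0.eq_or_lt with hz | hpos
  · obtain ⟨b, hb⟩ := hQ.bounded p
    obtain ⟨b', hb'⟩ := hQ.bounded (-p)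
    have h1 := hs.2.2.2 _ (hQ.sq_mul_mem g hb)
    have h2 := hs.2.2.2 _ (hQ.sq_mul_mem g hb')
    have e1 : g ^ 2 * (algebraMap ℝ A b - p) = b • g ^ 2 - g ^ 2 * p := by
      rw [Algebra.smul_def]; ring
    have e2 : g ^ 2 * (algebraMap ℝ A b' - -p) = b' • g ^ 2 + g ^ 2 * p := by
      rw [Algebra.smul_def]; ring
    rw [e1, states_sub hs, hs.2.1, ← hz] at h1
    rw [e2, hs.1, hs.2.1, ← hz] at h2
    rw [← hz]
    linarith
  · set t := φ (g ^ 2) with ht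
    have hct : 0 < c - t := by linarith
    let φ₁ : A → ℝ := fun q => t⁻¹ * φ (g ^ 2 * q)
    let φ₂ : A → ℝ := fun q => (c - t)⁻¹ * (c * φ q - φ (g ^ 2 * q))
    have h₁ : φ₁ ∈ states Q := by
      refine ⟨fun a b => ?_, fun a b => ?_, ?_, fun q hq => ?_⟩
      · simp only [φ₁, mul_add, hs.1]
      · simp only [φ₁, mul_smul_comm, hs.2.1]; ring
      · simp only [φ₁, mul_one, ← ht]; field_simp
      · exact mul_nonneg (by positivity) (hs.2.2.2 _ (hQ.sq_mul_mem g hq))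
    have h₂ : φ₂ ∈ states Q := by
      refine ⟨fun a b => ?_, fun a b => ?_, ?_, fun q hq => ?_⟩
      · simp only [φ₂, mul_add, hs.1]; ring
      · simp only [φ₂, mul_smul_comm, hs.2.1]; ring
      · simp only [φ₂, mul_one, ← ht, hs.2.2.1]; field_simp
      · exact mul_nonneg (by positivity) (sub_nonneg.2 (state_sq_mul_le hQ hs hq hc0 hcQ))
    have hseg : φ ∈ openSegment ℝ φ₁ φ₂ := by
      refine ⟨t / c, (c - t) / c, by positivity, by positivity, by field_simp; ring, ?_⟩
      ext q
      simp only [φ₁, φ₂, Pi.add_apply, Pi.smul_apply, smul_eq_mul]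
      field_simp
      ring
    have := congrFun (hφ.2 h₁ h₂ hseg) p
    simp only [φ₁] at this
    rw [← this]
    field_simp

theorem extreme_state_mul (hQ : IsArchimedeanModule Q) {φ : A → ℝ}
    (hφ : φ ∈ (states Q).extremePoints ℝ) (a b : A) : φ (a * b) = φ a * φ b := by
  have hs := hφ.1
  have h1 := extreme_state_sq_mul hQ hφ (a + 1) b
  have h2 := extreme_state_sq_mul hQ hφ (a - 1) b
  have e : (a + 1) ^ 2 * b = (a - 1) ^ 2 * b + (4 : ℝ) • (a * b) := by
    rw [Algebra.smul_def, map_ofNat]; ring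
  have e' : (a + 1) ^ 2 = (a - 1) ^ 2 + (4 : ℝ) • a := by
    rw [Algebra.smul_def, map_ofNat]; ring
  rw [e, e', hs.1, hs.1, hs.2.1, hs.2.1, h2] at h1
  linarith

/-- An element outside an Archimedean quadratic module takes a nonpositive value at some character
that is nonnegative on the module. -/
theorem exists_character_nonpos (hQ : IsArchimedeanModule Q) {f : A} (hf : f ∉ Q) :
    ∃ χ : A →ₐ[ℝ] ℝ, (∀ q ∈ Q, 0 ≤ χ q) ∧ χ f ≤ 0 := by
  obtain ⟨φ, hφ, hφf⟩ := exists_extreme_state_nonpos hQ hf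
  have hs := hφ.1
  exact ⟨AlgHom.ofLinearMap
    { toFun := φ, map_add' := hs.1, map_smul' := fun c a => by simpa using hs.2.1 c a }
    hs.2.2.1 (extreme_state_mul hQ hφ), hs.2.2.2, hφf⟩

end Putinar

/-! ### Quadratic modules of polynomials and Putinar's theorem -/

section TruncatedModule

variable {n s : ℕ} {w : Fin s → MvPolynomial (Fin n) ℝ}

theorem sosCone_mono {r r' : ℕ} (h : r ≤ r') : sosCone n r ⊆ sosCone n r' :=
  fun _ hσ => ⟨hσ.1, hσ.2.trans (by omega)⟩

theorem truncatedModule_mono {k k' : ℕ} (h : k ≤ k') :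
    truncatedModule w k ⊆ truncatedModule w k' := by
  rintro f ⟨σ₀, h₀, σ, hσ, rfl⟩
  exact ⟨σ₀, sosCone_mono h h₀, σ, fun j => (hσ j).imp_left fun hj =>
    ⟨hj.1.trans h, sosCone_mono (by omega) hj.2⟩, rfl⟩

/-- The quadratic module generated by the `w j`. -/
def quadraticModule (w : Fin s → MvPolynomial (Fin n) ℝ) : Set (MvPolynomial (Fin n) ℝ) :=
  {f | ∃ σ₀, IsSumSq σ₀ ∧ ∃ σ : Fin s → MvPolynomial (Fin n) ℝ, (∀ j, IsSumSq (σ j)) ∧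
    f = σ₀ + ∑ j, σ j * w j}

theorem truncatedModule_subset (k : ℕ) : truncatedModule w k ⊆ quadraticModule w := by
  rintro f ⟨σ₀, h₀, σ, hσ, rfl⟩
  refine ⟨σ₀, h₀.1, σ, fun j => ?_, rfl⟩
  rcases hσ j with h | h
  · exact h.2.1
  · rw [h]; exact IsSumSq.zero

theorem exists_mem_truncatedModule {f : MvPolynomial (Fin n) ℝ} (hf : f ∈ quadraticModule w) :
    ∃ k, f ∈ truncatedModule w k := by
  obtain ⟨σ₀, h₀, σ, hσ, rfl⟩ := hf
  let k := σ₀.totalDegree + ∑ j, (halfDegree (w j) + (σ j).totalDegree)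
  have hk : ∀ j, halfDegree (w j) + (σ j).totalDegree ≤ k := fun j =>
    (Finset.single_le_sum (f := fun j => halfDegree (w j) + (σ j).totalDegree)
      (fun _ _ => Nat.zero_le _) (Finset.mem_univ j)).trans (Nat.le_add_left _ _)
  refine ⟨k, σ₀, ⟨h₀, ?_⟩, σ, fun j => Or.inl ⟨?_, hσ j, ?_⟩, rfl⟩
  · have : σ₀.totalDegree ≤ k := Nat.le_add_right _ _
    omega
  · have := hk j; omega
  · have := hk j; omega

theorem IsSumSq.eval_nonneg {σ : MvPolynomial (Fin n) ℝ} (h : IsSumSq σ) (x : Fin n → ℝ) :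
    0 ≤ eval x σ := by
  induction h with
  | zero => simp
  | sq_add a _ ih => rw [map_add, map_mul]; exact add_nonneg (mul_self_nonneg _) ih

theorem eval_nonneg_of_mem_quadraticModule {f : MvPolynomial (Fin n) ℝ}
    (hf : f ∈ quadraticModule w) {x : Fin n → ℝ} (hx : x ∈ semialgebraicSet w) :
    0 ≤ eval x f := by
  obtain ⟨σ₀, h₀, σ, hσ, rfl⟩ := hf
  rw [map_add, map_sum]
  refine add_nonneg (IsSumSq.eval_nonneg h₀ x) (Finset.sum_nonneg fun j _ => ?_)
  rw [map_mul]
  exact mul_nonneg (IsSumSq.eval_nonneg (hσ j) x) (hx j)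

theorem quadraticModule_add_mem {a b : MvPolynomial (Fin n) ℝ} (ha : a ∈ quadraticModule w)
    (hb : b ∈ quadraticModule w) : a + b ∈ quadraticModule w := by
  obtain ⟨σ₀, h₀, σ, hσ, rfl⟩ := ha
  obtain ⟨τ₀, h₀', τ, hτ, rfl⟩ := hb
  refine ⟨σ₀ + τ₀, h₀.add h₀', σ + τ, fun j => (hσ j).add (hτ j), ?_⟩
  simp only [Pi.add_apply, add_mul, Finset.sum_add_distrib]
  ring

theorem quadraticModule_sq_mul_mem (a : MvPolynomial (Fin n) ℝ) {b : MvPolynomial (Fin n) ℝ}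
    (hb : b ∈ quadraticModule w) : a ^ 2 * b ∈ quadraticModule w := by
  obtain ⟨σ₀, h₀, σ, hσ, rfl⟩ := hb
  have ha : IsSumSq (a ^ 2) := by rw [sq]; exact IsSumSq.mul_self a
  refine ⟨a ^ 2 * σ₀, ha.mul h₀, fun j => a ^ 2 * σ j, fun j => ha.mul (hσ j), ?_⟩
  simp only [mul_add, Finset.mul_sum, mul_assoc]

theorem quadraticModule_of_isSumSq {a : MvPolynomial (Fin n) ℝ} (ha : IsSumSq a) :
    a ∈ quadraticModule w :=
  ⟨a, ha, 0, fun _ => IsSumSq.zero, by simp⟩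

/-- Boundedness of squares spreads from the variables to all polynomials: sums use `2 (a - p²) + 2
(b - q²) + (p - q)²`, products use `M (a - p²) + p² (M - Xᵢ²)`. -/
theorem exists_sq_bound (h : Archimedean w) (p : MvPolynomial (Fin n) ℝ) :
    ∃ c : ℝ, 0 ≤ c ∧ C c - p ^ 2 ∈ quadraticModule w := by
  have hsq : ∀ a : MvPolynomial (Fin n) ℝ, a ^ 2 ∈ quadraticModule w := fun a =>
    quadraticModule_of_isSumSq (by rw [sq]; exact IsSumSq.mul_self a)
  induction p using MvPolynomial.induction_on with
  | C a => exact ⟨a ^ 2, sq_nonneg a, by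
      rw [← C_pow, sub_self]; exact quadraticModule_of_isSumSq IsSumSq.zero⟩
  | add p q hp hq =>
    obtain ⟨a, ha, hp⟩ := hp
    obtain ⟨b, hb, hq⟩ := hq
    refine ⟨2 * a + 2 * b, by positivity, ?_⟩
    have := quadraticModule_add_mem (quadraticModule_add_mem (quadraticModule_add_mem hp hp)
      (quadraticModule_add_mem hq hq)) (hsq (p - q))
    convert this using 1
    rw [two_mul, two_mul, C_add, C_add, C_add]
    ring
  | mul_X p i hp =>
    obtain ⟨a, ha, hp⟩ := hp
    obtain ⟨M, hM, k, hk⟩ := h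
    have hX : C M - X i ^ 2 ∈ quadraticModule w := by
      have h1 : ∑ j ∈ Finset.univ.erase i, (X j : MvPolynomial (Fin n) ℝ) ^ 2 ∈
          quadraticModule w :=
        quadraticModule_of_isSumSq (IsSumSq.sum_sq _ _)
      have h2 := quadraticModule_add_mem (truncatedModule_subset k hk) h1
      rw [← Finset.add_sum_erase _ _ (Finset.mem_univ i)] at h2
      convert h2 using 1
      ring
    refine ⟨M * a, by positivity, ?_⟩
    have h1 : C M * (C a - p ^ 2) ∈ quadraticModule w := by
      have := quadraticModule_sq_mul_mem (C (√M)) hp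
      rwa [← C_pow, Real.sq_sqrt hM.le] at this
    have h2 := quadraticModule_add_mem h1 (quadraticModule_sq_mul_mem p hX)
    convert h2 using 1
    rw [C_mul]
    ring

theorem isArchimedeanModule_quadraticModule (h : Archimedean w) :
    IsArchimedeanModule (quadraticModule w) where
  one_mem := quadraticModule_of_isSumSq (by simp)
  add_mem := quadraticModule_add_mem
  sq_mul_mem := quadraticModule_sq_mul_mem
  bounded a := by
    obtain ⟨c, -, hc⟩ := exists_sq_bound h a
    refine ⟨c + 1 / 4, ?_⟩
    -- `c + 1/4 - a = (c - a²) + (a - 1/2)²`.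
    have h1 : (a - C (1 / 2)) ^ 2 ∈ quadraticModule w :=
      quadraticModule_of_isSumSq (by rw [sq]; exact IsSumSq.mul_self _)
    have h2 := quadraticModule_add_mem hc h1
    convert h2 using 1
    have e : (C (1 / 4) : MvPolynomial (Fin n) ℝ) = C (1 / 2) ^ 2 := by
      rw [← C_pow]; norm_num
    have e' : (1 : MvPolynomial (Fin n) ℝ) = 2 * C (1 / 2) := by
      rw [← C_1, ← map_ofNat (C : ℝ →+* MvPolynomial (Fin n) ℝ) 2, ← C_mul]; norm_num
    rw [MvPolynomial.algebraMap_eq, C_add, e]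
    linear_combination (-a) * e'

/-- **Putinar's Positivstellensatz**. -/
theorem exists_mem_truncatedModule_of_pos (h : Archimedean w) {f : MvPolynomial (Fin n) ℝ}
    (hf : ∀ x ∈ semialgebraicSet w, 0 < eval x f) : ∃ k, f ∈ truncatedModule w k := by
  apply exists_mem_truncatedModule
  by_contra hfQ
  obtain ⟨χ, hχ, hχf⟩ := exists_character_nonpos (isArchimedeanModule_quadraticModule h) hfQ
  have key : ∀ p, χ p = eval (χ ∘ X) p := fun p => by
    rw [← MvPolynomial.coe_aeval_eq_eval]
    exact congrArg (fun ψ : MvPolynomial (Fin n) ℝ →ₐ[ℝ] ℝ => ψ p) (aeval_unique χ)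
  have hx : (χ ∘ X) ∈ semialgebraicSet w := fun j => by
    rw [← key]
    refine hχ _ ⟨0, IsSumSq.zero, Pi.single j 1, fun i => ?_, ?_⟩
    · by_cases hij : i = j
      · subst hij; simp
      · rw [Pi.single_eq_of_ne hij]; exact IsSumSq.zero
    · rw [Finset.sum_eq_single j] <;> simp +contextual
  exact (hf _ hx).not_ge (by rw [← key]; exact hχf)

end TruncatedModule

/-! ### Coefficientwise topology and coordinates in bounded degree -/

section CoeffTopology

variable {n : ℕ}

/-- The topology of coefficientwise convergence. -/
scoped instance coeffTopology : TopologicalSpace (MvPolynomial (Fin n) ℝ) :=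
  TopologicalSpace.induced (fun p (α : Fin n →₀ ℕ) => coeff α p) inferInstance

theorem isInducing_coeff :
    IsInducing (fun (p : MvPolynomial (Fin n) ℝ) (α : Fin n →₀ ℕ) => coeff α p) := ⟨rfl⟩

theorem continuous_iff_coeff {X : Type*} [TopologicalSpace X] {f : X → MvPolynomial (Fin n) ℝ} :
    Continuous f ↔ ∀ α, Continuous fun x => coeff α (f x) := by
  rw [isInducing_coeff.continuous_iff, continuous_pi_iff]
  rfl

theorem tendsto_iff_coeff {X : Type*} {l : Filter X} {f : X → MvPolynomial (Fin n) ℝ}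
    {p : MvPolynomial (Fin n) ℝ} :
    Tendsto f l (𝓝 p) ↔ ∀ α, Tendsto (fun x => coeff α (f x)) l (𝓝 (coeff α p)) := by
  rw [isInducing_coeff.tendsto_nhds_iff, tendsto_pi_nhds]
  rfl

theorem continuous_coeff (α : Fin n →₀ ℕ) :
    Continuous fun p : MvPolynomial (Fin n) ℝ => coeff α p :=
  continuous_iff_coeff.1 continuous_id α

instance : T2Space (MvPolynomial (Fin n) ℝ) :=
  .of_injective_continuous (fun _ _ h => MvPolynomial.ext _ _ (congrFun h))
    isInducing_coeff.continuous

instance : FirstCountableTopology (MvPolynomial (Fin n) ℝ) :=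
  isInducing_coeff.firstCountableTopology

instance : ContinuousAdd (MvPolynomial (Fin n) ℝ) :=
  ⟨continuous_iff_coeff.2 fun α => by
    simp only [coeff_add]
    exact ((continuous_coeff α).comp continuous_fst).add ((continuous_coeff α).comp continuous_snd)⟩

instance : ContinuousMul (MvPolynomial (Fin n) ℝ) :=
  ⟨continuous_iff_coeff.2 fun α => by
    simp only [coeff_mul]
    exact continuous_finsetSum _ fun x _ =>
      ((continuous_coeff x.1).comp continuous_fst).mul ((continuous_coeff x.2).comp continuous_snd)⟩

/-- The exponents of degree at most `r`. -/
abbrev BoundedExponent (n r : ℕ) : Type := {α : Fin n →₀ ℕ // α.degree ≤ r}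

instance (r : ℕ) : Finite (BoundedExponent n r) :=
  (Finsupp.finite_of_degree_le (σ := Fin n) r).to_subtype

noncomputable instance (r : ℕ) : Fintype (BoundedExponent n r) := Fintype.ofFinite _

/-- The polynomial of degree at most `r` with given coefficients. -/
noncomputable def ofCoeffs (r : ℕ) : (BoundedExponent n r → ℝ) →ₗ[ℝ] MvPolynomial (Fin n) ℝ :=
  ∑ α : BoundedExponent n r, (monomial (α : Fin n →₀ ℕ)) ∘ₗ LinearMap.proj α

theorem ofCoeffs_apply (r : ℕ) (v : BoundedExponent n r → ℝ) :
    ofCoeffs r v = ∑ α : BoundedExponent n r, monomial (α : Fin n →₀ ℕ) (v α) := by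
  simp [ofCoeffs]

theorem coeff_ofCoeffs (r : ℕ) (v : BoundedExponent n r → ℝ) (β : Fin n →₀ ℕ) :
    coeff β (ofCoeffs r v) = if h : β.degree ≤ r then v ⟨β, h⟩ else 0 := by
  classical
  simp only [ofCoeffs_apply, coeff_sum, coeff_monomial]
  split_ifs with h
  · rw [Finset.sum_eq_single (⟨β, h⟩ : BoundedExponent n r)]
    · simp
    · intro b _ hb
      rw [if_neg]
      rintro rfl
      exact hb rfl
    · simp
  · refine Finset.sum_eq_zero fun b _ => if_neg ?_
    rintro rfl
    exact h b.2

theorem coeff_eq_zero_of_degree {p : MvPolynomial (Fin n) ℝ} {r : ℕ} (hp : p.totalDegree ≤ r)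
    {β : Fin n →₀ ℕ} (hβ : r < β.degree) : coeff β p = 0 := by
  by_contra h
  have := le_totalDegree (mem_support_iff.2 h)
  rw [Finsupp.degree_eq_sum] at hβ
  rw [Finsupp.sum_fintype _ _ (by simp)] at this
  omega

theorem totalDegree_le_of_coeff {p : MvPolynomial (Fin n) ℝ} {r : ℕ}
    (h : ∀ β : Fin n →₀ ℕ, r < β.degree → coeff β p = 0) : p.totalDegree ≤ r := by
  refine Finset.sup_le fun β hβ => ?_
  by_contra! hlt
  refine mem_support_iff.1 hβ (h β ?_)
  rw [Finsupp.degree_eq_sum]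
  rwa [Finsupp.sum_fintype _ _ (by simp)] at hlt

theorem ofCoeffs_coeff {p : MvPolynomial (Fin n) ℝ} {r : ℕ} (hp : p.totalDegree ≤ r) :
    ofCoeffs r (fun α => coeff (α : Fin n →₀ ℕ) p) = p := by
  ext β
  rw [coeff_ofCoeffs]
  split_ifs with h
  · rfl
  · exact (coeff_eq_zero_of_degree hp (not_le.1 h)).symm

theorem totalDegree_ofCoeffs_le (r : ℕ) (v : BoundedExponent n r → ℝ) :
    (ofCoeffs r v).totalDegree ≤ r :=
  totalDegree_le_of_coeff fun β hβ => by rw [coeff_ofCoeffs, dif_neg (not_le.2 hβ)]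

theorem ofCoeffs_eq_zero {r : ℕ} {v : BoundedExponent n r → ℝ} (h : ofCoeffs r v = 0) : v = 0 := by
  ext α
  have := coeff_ofCoeffs r v α
  rw [h, dif_pos α.2] at this
  simpa using this.symm

theorem continuous_ofCoeffs (r : ℕ) :
    Continuous (ofCoeffs r : (BoundedExponent n r → ℝ) → MvPolynomial (Fin n) ℝ) := by
  refine continuous_iff_coeff.2 fun β => ?_
  simp only [coeff_ofCoeffs]
  split_ifs
  · exact continuous_apply _
  · exact continuous_const

theorem continuous_eval_ofCoeffs (r : ℕ) (x : Fin n → ℝ) :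
    Continuous fun v : BoundedExponent n r → ℝ => eval x (ofCoeffs r v) :=
  ((aeval x).toLinearMap ∘ₗ ofCoeffs r).continuous_of_finiteDimensional

theorem tendsto_eval {r : ℕ} {p : ℕ → MvPolynomial (Fin n) ℝ} {q : MvPolynomial (Fin n) ℝ}
    (hp : ∀ i, (p i).totalDegree ≤ r) (hq : q.totalDegree ≤ r) (h : Tendsto p atTop (𝓝 q))
    (x : Fin n → ℝ) : Tendsto (fun i => eval x (p i)) atTop (𝓝 (eval x q)) := by
  have h1 : Tendsto (fun i (α : BoundedExponent n r) => coeff (α : Fin n →₀ ℕ) (p i)) atTop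
      (𝓝 fun α => coeff (α : Fin n →₀ ℕ) q) :=
    tendsto_pi_nhds.2 fun α => tendsto_iff_coeff.1 h α
  have h2 := ((continuous_eval_ofCoeffs r x).tendsto _).comp h1
  rw [ofCoeffs_coeff hq] at h2
  exact h2.congr fun i => by rw [Function.comp_apply, ofCoeffs_coeff (hp i)]

theorem isClosed_isHomogeneous (d : ℕ) :
    IsClosed {g : MvPolynomial (Fin n) ℝ | g.IsHomogeneous d} := by
  have h : {g : MvPolynomial (Fin n) ℝ | g.IsHomogeneous d} =
      ⋂ α : Fin n →₀ ℕ, ⋂ _ : α.degree ≠ d, {g | coeff α g = 0} := by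
    ext g
    simp only [Set.mem_ofPred_eq, Set.mem_iInter]
    constructor
    · intro hg α hα
      exact hg.coeff_eq_zero hα
    · intro hg α hα
      by_contra hne
      refine hα (hg α ?_)
      rwa [Finsupp.degree_eq_weight_one]
  rw [h]
  exact isClosed_iInter fun α => isClosed_iInter fun _ =>
    isClosed_eq (continuous_coeff α) continuous_const

end CoeffTopology

/-! ### Finite determining sets and compactness of bounded forms -/

section Determining

variable {n : ℕ}

/-- A finite set on which every nonzero polynomial of degree at most `r` has a nonzero value. -/
def IsDetermining (P : Finset (Fin n → ℝ)) (r : ℕ) : Prop :=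
  ∀ p : MvPolynomial (Fin n) ℝ, p.totalDegree ≤ r → (∀ x ∈ P, eval x p = 0) → p = 0

theorem IsDetermining.mono {P : Finset (Fin n → ℝ)} {r r' : ℕ} (h : IsDetermining P r)
    (hr : r' ≤ r) : IsDetermining P r' :=
  fun p hp => h p (hp.trans hr)

/-- A sup-norm ball is a product of intervals, so it contains a grid with `r + 1` nodes in each
coordinate. -/
theorem exists_isDetermining {U : Set (Fin n → ℝ)} (hU : IsOpen U) (hne : U.Nonempty) (r : ℕ) :
    ∃ P : Finset (Fin n → ℝ), ↑P ⊆ U ∧ IsDetermining P r := by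
  obtain ⟨x, hx⟩ := hne
  obtain ⟨ε, hε, hball⟩ := Metric.isOpen_iff.1 hU x hx
  have hinf : ∀ i, (Metric.ball (x i) ε).Infinite := fun i => by
    rw [Real.ball_eq_Ioo]
    exact Set.Ioo_infinite (by linarith)
  choose S hS hcard using fun i => (hinf i).exists_subset_card_eq (r + 1)
  refine ⟨Fintype.piFinset S, fun y hy => hball ?_, fun p hp h => ?_⟩
  · rw [Finset.mem_coe, Fintype.mem_piFinset] at hy
    rw [ball_pi x hε]
    exact fun i _ => hS i (hy i)
  · refine eq_zero_of_eval_zero_at_prod_finset p S (fun i => ?_) fun y hy =>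
      h y (Fintype.mem_piFinset.2 hy)
    rw [hcard]
    exact Nat.lt_succ_of_le ((degreeOf_le_totalDegree p i).trans hp)

theorem exists_eval_ne_zero {U : Set (Fin n → ℝ)} (hU : IsOpen U) (hne : U.Nonempty)
    {p : MvPolynomial (Fin n) ℝ} (hp : p ≠ 0) : ∃ x ∈ U, eval x p ≠ 0 := by
  obtain ⟨P, hPU, hP⟩ := exists_isDetermining hU hne p.totalDegree
  by_contra! h
  exact hp (hP p le_rfl fun x hx => h x (hPU hx))

theorem isCompact_sublevel_of_quadratic {E : Type*} [NormedAddCommGroup E] [NormedSpace ℝ E]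
    [FiniteDimensional ℝ E] {q : E → ℝ} (hq : Continuous q)
    (hsmul : ∀ (c : ℝ) v, q (c • v) = c ^ 2 * q v) (hpos : ∀ v, v ≠ 0 → 0 < q v) (c : ℝ) :
    IsCompact {v | q v ≤ c} := by
  have : ProperSpace E := FiniteDimensional.proper ℝ E
  obtain ⟨m, hm, hmq⟩ : ∃ m : ℝ, 0 < m ∧ ∀ v, m * ‖v‖ ^ 2 ≤ q v := by
    have h0 : q 0 = 0 := by simpa using hsmul 0 0
    -- The unit sphere is empty when `E` is trivial; otherwise `m` is the minimum of `q` on it.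
    rcases (Metric.sphere (0 : E) 1).eq_empty_or_nonempty with he | hne
    · refine ⟨1, one_pos, fun v => ?_⟩
      by_cases hv : v = 0
      · simp [hv, h0]
      · have : ‖v‖⁻¹ • v ∈ Metric.sphere (0 : E) 1 := by
          simp [norm_smul, hv]
        rw [he] at this
        exact this.elim
    · obtain ⟨u, hu, hmin⟩ := (isCompact_sphere (0 : E) 1).exists_isMinOn hne hq.continuousOn
      have hu1 : ‖u‖ = 1 := by simpa using hu
      refine ⟨q u, hpos u (by rintro rfl; simp at hu1), fun v => ?_⟩
      by_cases hv : v = 0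
      · simp [hv, h0]
      · have hv' : 0 < ‖v‖ := norm_pos_iff.2 hv
        have h1 : q u ≤ q (‖v‖⁻¹ • v) := hmin (by simp [norm_smul, hv])
        rw [hsmul] at h1
        calc q u * ‖v‖ ^ 2 ≤ ‖v‖⁻¹ ^ 2 * q v * ‖v‖ ^ 2 := by gcongr
          _ = q v := by field_simp
  refine Metric.isCompact_of_isClosed_isBounded (isClosed_le hq continuous_const) ?_
  refine (Metric.isBounded_closedBall (x := (0 : E)) (r := √(c / m))).subset fun v hv => ?_
  rw [mem_closedBall_zero_iff]
  refine Real.le_sqrt_of_sq_le ?_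
  rw [le_div_iff₀ hm]
  have := hmq v
  have hv' : q v ≤ c := hv
  linarith

theorem exists_isCompact_forms {P : Finset (Fin n → ℝ)} {d : ℕ} (hP : IsDetermining P d) :
    ∃ T : Set (MvPolynomial (Fin n) ℝ), IsCompact T ∧ (∀ g ∈ T, g.IsHomogeneous d) ∧
      ∀ g : MvPolynomial (Fin n) ℝ, g.IsHomogeneous d →
        (∀ x ∈ P, 0 ≤ eval x g ∧ eval x g ≤ 1) → g ∈ T := by
  let q : (BoundedExponent n d → ℝ) → ℝ := fun v => ∑ x ∈ P, (eval x (ofCoeffs d v)) ^ 2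
  have hqc : Continuous q :=
    continuous_finsetSum _ fun x _ => (continuous_eval_ofCoeffs d x).pow 2
  have hq : IsCompact {v | q v ≤ P.card} := by
    refine isCompact_sublevel_of_quadratic hqc ?_ ?_ _
    · intro c v
      simp only [q, map_smul, smul_eval, mul_pow, Finset.mul_sum]
    · intro v hv
      refine (Finset.sum_nonneg fun x _ => sq_nonneg _).lt_of_ne' fun h => hv ?_
      refine ofCoeffs_eq_zero (hP _ (totalDegree_ofCoeffs_le d v) fun x hx => ?_)
      exact pow_eq_zero_iff two_ne_zero |>.1
        ((Finset.sum_eq_zero_iff_of_nonneg fun x _ => sq_nonneg _).1 h x hx)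
  refine ⟨ofCoeffs d '' {v | q v ≤ P.card} ∩ {g | g.IsHomogeneous d},
    (hq.image (continuous_ofCoeffs d)).inter_right (isClosed_isHomogeneous d),
    fun g hg => hg.2, fun g hg hx => ⟨⟨fun α => coeff (α : Fin n →₀ ℕ) g, ?_, ?_⟩, hg⟩⟩
  · simp only [Set.mem_ofPred_eq, q, ofCoeffs_coeff hg.totalDegree_le]
    calc ∑ x ∈ P, eval x g ^ 2 ≤ ∑ x ∈ P, (1 : ℝ) :=
          Finset.sum_le_sum fun x h => pow_le_one₀ (hx x h).1 (hx x h).2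
      _ = P.card := by simp
  · exact ofCoeffs_coeff hg.totalDegree_le

end Determining

/-! ### Gram matrices and compact pieces of the truncated module -/

section SumsOfSquares

variable {n : ℕ}

open MonomialOrder in
-- Nonnegative leading coefficients cannot cancel; hence each square in a sum of squares obeys the
-- degree bound of the sum.
theorem degree_le_degree_add {a b : MvPolynomial (Fin n) ℝ}
    (ha : 0 ≤ degLex.leadingCoeff a) (hb : 0 ≤ degLex.leadingCoeff b) :
    degLex.degree a ≼[degLex] degLex.degree (a + b) ∧ 0 ≤ degLex.leadingCoeff (a + b) := by
  rcases lt_trichotomy (degLex.toSyn (degLex.degree a)) (degLex.toSyn (degLex.degree b))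
    with h | h | h
  · rw [add_comm a b, degree_add_of_lt h, leadingCoeff_add_of_lt h]
    exact ⟨h.le, hb⟩
  · have hdeg : degLex.degree a = degLex.degree b := degLex.toSyn.injective h
    by_cases ha0 : a = 0
    · subst ha0
      simpa [hdeg] using hb
    have hpos : 0 < coeff (degLex.degree a) (a + b) := by
      rw [coeff_add]
      refine add_pos_of_pos_of_nonneg (lt_of_le_of_ne ha ?_) (by rw [hdeg]; exact hb)
      exact (degLex.leadingCoeff_ne_zero_iff.2 ha0).symm
    have h1 : degLex.degree a ≼[degLex] degLex.degree (a + b) :=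
      degLex.le_degree (mem_support_iff.2 hpos.ne')
    have h2 : degLex.degree (a + b) ≼[degLex] degLex.degree a := by
      refine degLex.degree_add_le.trans ?_
      rw [← h, sup_idem]
    have h3 : degLex.degree (a + b) = degLex.degree a :=
      degLex.toSyn.injective (le_antisymm h2 h1)
    refine ⟨h1, ?_⟩
    rw [leadingCoeff, h3]
    exact hpos.le
  · rw [degree_add_of_lt h, leadingCoeff_add_of_lt h]
    exact ⟨le_rfl, ha⟩

theorem leadingCoeff_nonneg_of_isSumSq {σ : MvPolynomial (Fin n) ℝ} (h : IsSumSq σ) :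
    0 ≤ MonomialOrder.degLex.leadingCoeff σ := by
  induction h with
  | zero => simp
  | sq_add a _ ih =>
    refine (degree_le_degree_add ?_ ih).2
    rw [MonomialOrder.leadingCoeff_mul]
    exact mul_self_nonneg _

theorem totalDegree_le_of_isSumSq {a b : MvPolynomial (Fin n) ℝ} (ha : IsSumSq a)
    (hb : IsSumSq b) : a.totalDegree ≤ (a + b).totalDegree :=
  degLex_totalDegree_monotone (degree_le_degree_add (leadingCoeff_nonneg_of_isSumSq ha)
    (leadingCoeff_nonneg_of_isSumSq hb)).1

theorem totalDegree_le_of_mul_self {a : MvPolynomial (Fin n) ℝ} {r : ℕ}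
    (h : (a * a).totalDegree ≤ 2 * r) : a.totalDegree ≤ r := by
  by_cases ha : a = 0
  · simp [ha]
  · rw [totalDegree_mul_of_isDomain ha ha] at h
    omega

/-- A sum of squares of degree at most `2 * r` is given by a positive semidefinite Gram matrix. -/
theorem exists_posSemidef_of_mem_sosCone {r : ℕ} {σ : MvPolynomial (Fin n) ℝ}
    (h : σ ∈ sosCone n r) : ∃ G : Matrix (BoundedExponent n r) (BoundedExponent n r) ℝ,
      G.PosSemidef ∧ σ = ∑ α, ∑ β, monomial (α.1 + β.1) (G α β) := by
  obtain ⟨hσ, hdeg⟩ := h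
  induction hσ with
  | zero => exact ⟨0, Matrix.PosSemidef.zero, by simp⟩
  | @sq_add a t ht ih =>
    have h1 := totalDegree_le_of_isSumSq (IsSumSq.mul_self a) ht
    have h2 := totalDegree_le_of_isSumSq ht (IsSumSq.mul_self a)
    rw [add_comm] at h2
    obtain ⟨G, hG, hGt⟩ := ih (h2.trans hdeg)
    have ha := totalDegree_le_of_mul_self (h1.trans hdeg)
    let v : BoundedExponent n r → ℝ := fun α => coeff (α : Fin n →₀ ℕ) a
    refine ⟨Matrix.vecMulVec v v + G, ?_, ?_⟩
    · exact (by simpa using Matrix.posSemidef_vecMulVec_self_star v :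
        (Matrix.vecMulVec v v).PosSemidef).add hG
    · have hav : a = ∑ α, monomial α.1 (v α) := by
        rw [← ofCoeffs_apply]; exact (ofCoeffs_coeff ha).symm
      simp only [Matrix.add_apply, Matrix.vecMulVec_apply, map_add, Finset.sum_add_distrib]
      rw [← hGt]
      congr 1
      conv_lhs => rw [hav, Finset.sum_mul_sum]
      simp only [monomial_mul]

open scoped MatrixOrder Matrix.Norms.L2Operator in
-- Factoring the Gram matrix as `star B * B` fixes the number of squares, so the cone is a
-- continuous image of a finite-dimensional space.
theorem exists_sum_sq_of_mem_sosCone {r : ℕ} {σ : MvPolynomial (Fin n) ℝ} (h : σ ∈ sosCone n r) :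
    ∃ B : BoundedExponent n r → BoundedExponent n r → ℝ, σ = ∑ γ, ofCoeffs r (B γ) ^ 2 := by
  classical
  obtain ⟨G, hG, rfl⟩ := exists_posSemidef_of_mem_sosCone h
  obtain ⟨B, rfl⟩ := CStarAlgebra.nonneg_iff_eq_star_mul_self.1 hG.nonneg
  refine ⟨B, ?_⟩
  simp only [ofCoeffs_apply, sq, Finset.sum_mul_sum, monomial_mul, Matrix.mul_apply, map_sum,
    Matrix.star_apply, star_trivial]
  rw [Finset.sum_comm' (t' := Finset.univ) (s' := fun _ => Finset.univ) (by simp)]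
  rw [Finset.sum_comm]
  conv_rhs => rw [Finset.sum_comm]
  refine Finset.sum_congr rfl fun α _ => ?_
  rw [Finset.sum_comm]

theorem exists_isCompact_sosCone {P : Finset (Fin n → ℝ)} {r : ℕ} (hP : IsDetermining P r)
    (c : ℝ) : ∃ T : Set (MvPolynomial (Fin n) ℝ), IsCompact T ∧ T ⊆ sosCone n r ∧
      ∀ σ ∈ sosCone n r, ∑ x ∈ P, eval x σ ≤ c → σ ∈ T := by
  let q : (BoundedExponent n r → BoundedExponent n r → ℝ) → ℝ :=
    fun B => ∑ γ, ∑ x ∈ P, (eval x (ofCoeffs r (B γ))) ^ 2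
  have hqc : Continuous q :=
    continuous_finsetSum _ fun γ _ => continuous_finsetSum _ fun x _ =>
      ((continuous_eval_ofCoeffs r x).comp (continuous_apply γ)).pow 2
  have hq : IsCompact {B | q B ≤ c} := by
    refine isCompact_sublevel_of_quadratic hqc ?_ ?_ _
    · intro c v
      simp only [q, Pi.smul_apply, map_smul, smul_eval, mul_pow, Finset.mul_sum]
    · intro B hB
      have hnn : ∀ γ, 0 ≤ ∑ x ∈ P, (eval x (ofCoeffs r (B γ))) ^ 2 := fun γ =>
        Finset.sum_nonneg fun x _ => sq_nonneg _
      refine (Finset.sum_nonneg fun γ _ => hnn γ).lt_of_ne' fun h => hB ?_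
      funext γ
      refine ofCoeffs_eq_zero (hP _ (totalDegree_ofCoeffs_le r _) fun x hx => ?_)
      have h1 := (Finset.sum_eq_zero_iff_of_nonneg fun γ _ => hnn γ).1 h γ (Finset.mem_univ γ)
      exact pow_eq_zero_iff two_ne_zero |>.1
        ((Finset.sum_eq_zero_iff_of_nonneg fun x _ => sq_nonneg _).1 h1 x hx)
  refine ⟨(fun B => ∑ γ, ofCoeffs r (B γ) ^ 2) '' {B | q B ≤ c}, hq.image ?_, ?_, ?_⟩
  · exact continuous_finsetSum _ fun γ _ =>
      ((continuous_ofCoeffs r).comp (continuous_apply γ)).pow 2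
  · rintro _ ⟨B, -, rfl⟩
    refine ⟨IsSumSq.sum_sq _ _, totalDegree_finsetSum_le fun γ _ => ?_⟩
    exact (totalDegree_pow _ _).trans (Nat.mul_le_mul_left 2 (totalDegree_ofCoeffs_le r _))
  · intro σ hσ hc
    obtain ⟨B, rfl⟩ := exists_sum_sq_of_mem_sosCone hσ
    refine ⟨B, ?_, rfl⟩
    simp only [map_sum, map_pow] at hc
    rw [Finset.sum_comm] at hc
    exact hc

/-- All terms of a certificate are nonnegative on `P`, so a bound on the sum bounds each term;
dividing by `w j > 0` bounds the multipliers. -/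
theorem exists_isCompact_truncatedModule {s k : ℕ} {w : Fin s → MvPolynomial (Fin n) ℝ}
    {P : Finset (Fin n → ℝ)} (hP : IsDetermining P k)
    (hpos : ∀ x ∈ P, ∀ j, w j ≠ 0 → 0 < eval x (w j)) (c : ℝ) :
    ∃ T : Set (MvPolynomial (Fin n) ℝ), IsCompact T ∧ T ⊆ truncatedModule w k ∧
      ∀ f ∈ truncatedModule w k, ∑ x ∈ P, eval x f ≤ c → f ∈ T := by
  obtain ⟨T₀, hT₀, hT₀s, hT₀c⟩ := exists_isCompact_sosCone hP c
  choose T hT hTs hTc using fun j => exists_isCompact_sosCone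
    (hP.mono (Nat.sub_le k (halfDegree (w j)))) (∑ x ∈ P, c / eval x (w j))
  let T' : Fin s → Set (MvPolynomial (Fin n) ℝ) :=
    fun j => {σ | halfDegree (w j) ≤ k ∧ σ ∈ T j} ∪ {0}
  have hT' : ∀ j, IsCompact (T' j) := fun j => by
    refine IsCompact.union ?_ isCompact_singleton
    by_cases h : halfDegree (w j) ≤ k
    · simpa [h] using hT j
    · simp [h]
  refine ⟨(fun p : MvPolynomial (Fin n) ℝ × (Fin s → MvPolynomial (Fin n) ℝ) =>
    p.1 + ∑ j, p.2 j * w j) '' (T₀ ×ˢ Set.univ.pi T'),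
    (hT₀.prod (isCompact_univ_pi hT')).image (by fun_prop), ?_, ?_⟩
  · rintro _ ⟨⟨σ₀, σ⟩, ⟨h₀, hσ⟩, rfl⟩
    refine ⟨σ₀, hT₀s h₀, σ, fun j => ?_, rfl⟩
    rcases hσ j (Set.mem_univ j) with h | h
    · exact Or.inl ⟨h.1, hTs j h.2⟩
    · exact Or.inr h
  · rintro f ⟨σ₀, h₀, σ, hσ, rfl⟩ hc
    classical
    have hsos : ∀ j, IsSumSq (σ j) := fun j => by
      rcases hσ j with h | h
      · exact h.2.1
      · rw [h]; exact IsSumSq.zero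
    have hterm : ∀ x ∈ P, ∀ j, 0 ≤ eval x (σ j) * eval x (w j) := fun x hx j => by
      by_cases hw : w j = 0
      · simp [hw]
      · exact mul_nonneg (IsSumSq.eval_nonneg (hsos j) x) (hpos x hx j hw).le
    have hev : ∀ x, eval x (σ₀ + ∑ j, σ j * w j) =
        eval x σ₀ + ∑ j, eval x (σ j) * eval x (w j) := fun x => by simp
    have hnn : ∀ x ∈ P, 0 ≤ eval x (σ₀ + ∑ j, σ j * w j) := fun x hx => by
      rw [hev]
      exact add_nonneg (IsSumSq.eval_nonneg h₀.1 x) (Finset.sum_nonneg fun j _ => hterm x hx j)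
    have hle : ∀ x ∈ P, eval x (σ₀ + ∑ j, σ j * w j) ≤ c := fun x hx =>
      (Finset.single_le_sum hnn hx).trans hc
    -- A multiplier of `w j = 0` is unconstrained by `f`, so it is replaced by `0`.
    refine ⟨(σ₀, fun j => if w j = 0 then 0 else σ j), ⟨?_, fun j _ => ?_⟩, ?_⟩
    · refine hT₀c σ₀ h₀ (le_trans (Finset.sum_le_sum fun x hx => ?_) hc)
      rw [hev]
      exact le_add_of_nonneg_right (Finset.sum_nonneg fun j _ => hterm x hx j)
    · by_cases hw : w j = 0
      · simp [hw, T']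
      · simp only [if_neg hw]
        rcases hσ j with h | h
        · refine Or.inl ⟨h.1, hTc j _ h.2 (Finset.sum_le_sum fun x hx => ?_)⟩
          rw [le_div_iff₀ (hpos x hx j hw)]
          have h1 := hle x hx
          rw [hev] at h1
          have h2 := Finset.single_le_sum (f := fun j => eval x (σ j) * eval x (w j))
            (fun j _ => hterm x hx j) (Finset.mem_univ j)
          have h3 := IsSumSq.eval_nonneg h₀.1 x
          linarith
        · exact Or.inr h
    · simp only
      congr 1
      refine Finset.sum_congr rfl fun j _ => ?_
      by_cases hw : w j = 0 <;> simp [hw]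

end SumsOfSquares

/-! ### The objective: scaling, finiteness, semicontinuity, strict convexity -/

section Objective

variable {n d : ℕ}

theorem eval_smul_of_isHomogeneous {g : MvPolynomial (Fin n) ℝ} (hg : g.IsHomogeneous d) (t : ℝ)
    (x : Fin n → ℝ) : eval (t • x) g = t ^ d * eval x g := by
  rw [eval_eq, eval_eq, Finset.mul_sum]
  refine Finset.sum_congr rfl fun α hα => ?_
  have h1 : α.degree = d := by
    by_contra h
    exact mem_support_iff.1 hα (hg.coeff_eq_zero h)
  have h2 : ∏ i ∈ α.support, t ^ α i = t ^ d := by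
    rw [Finset.prod_pow_eq_pow_sum, ← h1, Finsupp.degree_apply]
  simp only [Pi.smul_apply, smul_eq_mul, mul_pow, Finset.prod_mul_distrib]
  rw [h2]
  ring

theorem measurable_objective_integrand (g : MvPolynomial (Fin n) ℝ) :
    Measurable fun x : Fin n → ℝ => ENNReal.ofReal (Real.exp (-(eval x g))) :=
  ENNReal.measurable_ofReal.comp
    (Real.continuous_exp.comp (MvPolynomial.continuous_eval g).neg).measurable

theorem objective_smul {g : MvPolynomial (Fin n) ℝ} (hg : g.IsHomogeneous d) {t : ℝ} (ht : 0 < t) :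
    objective (t ^ d • g) = ENNReal.ofReal (t ^ n)⁻¹ * objective g := by
  have h1 : objective (t ^ d • g) =
      ∫⁻ x : Fin n → ℝ, ENNReal.ofReal (Real.exp (-(eval (t • x) g))) := by
    simp only [objective, eval_smul_of_isHomogeneous hg, smul_eval]
  rw [h1, ← lintegral_map (measurable_objective_integrand g) (measurable_const_smul t),
    Measure.map_addHaar_smul _ ht.ne', lintegral_smul_measure]
  rw [Module.finrank_fin_fun, abs_of_nonneg (by positivity)]
  rfl

/-- If `g < -a < 0` on an open set `U`, then `exp (-t ^ d g) ≥ t a` there for `t ≥ 1`, while passing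
to `t ^ d • g` does not increase the objective. Large `t` contradicts finiteness. -/
theorem nonneg_of_objective_lt_top (hd : 0 < d) {g : MvPolynomial (Fin n) ℝ}
    (hg : g.IsHomogeneous d) (hfin : objective g < ∞) (x : Fin n → ℝ) : 0 ≤ eval x g := by
  by_contra! hx
  set a := -(eval x g) / 2 with ha
  have ha0 : 0 < a := by linarith
  let U : Set (Fin n → ℝ) := {y | eval y g < -a}
  have hU : IsOpen U := isOpen_lt (MvPolynomial.continuous_eval g) continuous_const
  have hvol : volume U ≠ 0 := (hU.measure_pos volume ⟨x, by
    change eval x g < -a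
    linarith⟩).ne'
  have key : ∀ t : ℝ, 1 ≤ t → ENNReal.ofReal (t * a) ≤ objective g / volume U := by
    intro t ht
    rw [ENNReal.le_div_iff_mul_le (Or.inl hvol) (Or.inr hfin.ne)]
    have h1 : objective (t ^ d • g) ≤ objective g := by
      rw [objective_smul hg (by linarith)]
      refine mul_le_of_le_one_left' (ENNReal.ofReal_le_one.2 ?_)
      exact inv_le_one_of_one_le₀ (one_le_pow₀ ht)
    refine le_trans ?_ h1
    rw [← setLIntegral_const]
    refine (setLIntegral_mono' hU.measurableSet fun y hy => ?_).trans
      (setLIntegral_le_lintegral U _)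
    refine ENNReal.ofReal_le_ofReal ?_
    rw [smul_eval]
    have hy' : eval y g < -a := hy
    have h2 : t ≤ t ^ d := le_self_pow₀ ht hd.ne'
    have h3 := Real.add_one_le_exp (-(t ^ d * eval y g))
    nlinarith
  have hdiv : objective g / volume U < ∞ := ENNReal.div_lt_top hfin.ne hvol
  set b := (objective g / volume U).toReal with hb
  have hb0 : 0 ≤ b := ENNReal.toReal_nonneg
  have h1 := key (b / a + 1) (by have : 0 ≤ b / a := by positivity
                                 linarith)
  rw [← ENNReal.ofReal_toReal hdiv.ne, ← hb, ENNReal.ofReal_le_ofReal_iff hb0, add_mul,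
    div_mul_cancel₀ _ ha0.ne'] at h1
  linarith

theorem mem_finiteVolumeForms (hd : 0 < d) {g : MvPolynomial (Fin n) ℝ}
    (hg : g.IsHomogeneous d) (hfin : objective g < ∞) : g ∈ finiteVolumeForms n d := by
  refine ⟨hg, nonneg_of_objective_lt_top hd hg hfin, ?_⟩
  -- Markov's inequality: `{g ≤ 1}` is the set where the integrand is at least `exp (-1)`.
  have h1 := mul_meas_ge_le_lintegral (μ := volume) (measurable_objective_integrand g)
    (ENNReal.ofReal (Real.exp (-1)))
  have h2 : {x : Fin n → ℝ | ENNReal.ofReal (Real.exp (-1)) ≤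
      ENNReal.ofReal (Real.exp (-(eval x g)))} = {x | eval x g ≤ 1} := by
    ext x
    simp only [Set.mem_ofPred_eq]
    rw [ENNReal.ofReal_le_ofReal_iff (Real.exp_pos _).le, Real.exp_le_exp, neg_le_neg_iff]
  rw [h2] at h1
  refine ENNReal.lt_top_of_mul_ne_top_right (h1.trans_lt hfin).ne ?_
  exact (ENNReal.ofReal_pos.2 (Real.exp_pos _)).ne'

theorem objective_le_liminf {r : ℕ} {p : ℕ → MvPolynomial (Fin n) ℝ} {q : MvPolynomial (Fin n) ℝ}
    (hp : ∀ i, (p i).totalDegree ≤ r) (hq : q.totalDegree ≤ r) (h : Tendsto p atTop (𝓝 q)) :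
    objective q ≤ liminf (fun i => objective (p i)) atTop := by
  refine le_trans (lintegral_mono fun x => ?_)
    (lintegral_liminf_le fun i => measurable_objective_integrand (p i))
  have h1 : Tendsto (fun i => ENNReal.ofReal (Real.exp (-(eval x (p i))))) atTop
      (𝓝 (ENNReal.ofReal (Real.exp (-(eval x q))))) :=
    (ENNReal.continuous_ofReal.tendsto _).comp
      ((Real.continuous_exp.tendsto _).comp (tendsto_eval hp hq h x).neg)
  exact h1.liminf_eq.ge

theorem exp_neg_midpoint_lt {a b : ℝ} (h : a ≠ b) :
    Real.exp (-((1 / 2) * (a + b))) < (1 / 2) * Real.exp (-a) + (1 / 2) * Real.exp (-b) := by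
  have := strictConvexOn_exp.2 (Set.mem_univ (-a)) (Set.mem_univ (-b))
    (fun h' => h (neg_injective h')) (by norm_num : (0 : ℝ) < 1 / 2)
    (by norm_num : (0 : ℝ) < 1 / 2) (by norm_num)
  simp only [smul_eq_mul] at this
  have e : -((1 / 2) * (a + b)) = 1 / 2 * -a + 1 / 2 * -b := by ring
  rwa [e]

/-- Convexity of `exp` is strict on the nonempty open set where `g` and `h` differ, which has
positive measure; finiteness of `ρ` preserves strictness under integration. -/
theorem objective_midpoint_lt {g h : MvPolynomial (Fin n) ℝ} (hne : g ≠ h) {ρ : ℝ≥0∞}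
    (hρ : ρ < ∞) (hg : objective g ≤ ρ) (hh : objective h ≤ ρ) :
    objective ((1 / 2 : ℝ) • (g + h)) < ρ := by
  let c : ℝ≥0∞ := ENNReal.ofReal (1 / 2)
  let G : (Fin n → ℝ) → ℝ≥0∞ := fun x => c * ENNReal.ofReal (Real.exp (-(eval x g))) +
    c * ENNReal.ofReal (Real.exp (-(eval x h)))
  have hGr : ∀ x, G x = ENNReal.ofReal
      ((1 / 2) * Real.exp (-(eval x g)) + (1 / 2) * Real.exp (-(eval x h))) := fun x => by
    rw [ENNReal.ofReal_add (by positivity) (by positivity), ENNReal.ofReal_mul (by norm_num),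
      ENNReal.ofReal_mul (by norm_num)]
  have hGint : ∫⁻ x, G x ≤ ρ := by
    rw [lintegral_add_left ((measurable_objective_integrand g).const_mul c),
      lintegral_const_mul c (measurable_objective_integrand g),
      lintegral_const_mul c (measurable_objective_integrand h)]
    calc c * objective g + c * objective h ≤ c * ρ + c * ρ := by gcongr
      _ = ρ := by
        rw [← add_mul, ← ENNReal.ofReal_add (by norm_num) (by norm_num)]
        norm_num
  have hmeas : Measurable G := ((measurable_objective_integrand g).const_mul c).add
    ((measurable_objective_integrand h).const_mul c)
  have hev : ∀ x : Fin n → ℝ, eval x ((1 / 2 : ℝ) • (g + h)) = (1 / 2) * (eval x g + eval x h) :=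
    fun x => by rw [smul_eval, map_add]
  have hlt : ∀ x : Fin n → ℝ, eval x g ≠ eval x h →
      ENNReal.ofReal (Real.exp (-(eval x ((1 / 2 : ℝ) • (g + h))))) < G x := fun x hx => by
    rw [hGr, hev, ENNReal.ofReal_lt_ofReal_iff (by positivity)]
    exact exp_neg_midpoint_lt hx
  have hle : ∀ x : Fin n → ℝ,
      ENNReal.ofReal (Real.exp (-(eval x ((1 / 2 : ℝ) • (g + h))))) ≤ G x := fun x => by
    by_cases hx : eval x g = eval x h
    · rw [hGr, hev, hx]
      refine ENNReal.ofReal_le_ofReal (le_of_eq ?_)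
      ring_nf
    · exact (hlt x hx).le
  have hopen : IsOpen {x : Fin n → ℝ | eval x g ≠ eval x h} :=
    isOpen_ne_fun (MvPolynomial.continuous_eval g) (MvPolynomial.continuous_eval h)
  have hnonempty : {x : Fin n → ℝ | eval x g ≠ eval x h}.Nonempty := by
    by_contra! he
    refine hne (MvPolynomial.funext fun x => ?_)
    by_contra hx
    exact Set.eq_empty_iff_forall_notMem.1 he x hx
  refine lt_of_lt_of_le ?_ hGint
  refine lintegral_strict_mono_of_ae_le_of_ae_lt_on hmeas.aemeasurable ?_
    (Eventually.of_forall hle) (hopen.measure_pos volume hnonempty).ne'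
    (Eventually.of_forall fun x hx => hlt x hx)
  exact ((lintegral_mono hle).trans_lt (hGint.trans_lt hρ)).ne

theorem integrable_exp_neg_mul_even_pow (hd : Even d) (hd0 : 0 < d) {ε : ℝ} (hε : 0 < ε) :
    Integrable fun x : ℝ => Real.exp (-(ε * x ^ d)) := by
  refine ((integrable_exp_neg_mul_sq hε).const_mul (Real.exp ε)).mono'
    (by fun_prop) (Eventually.of_forall fun x => ?_)
  rw [Real.norm_eq_abs, abs_of_pos (Real.exp_pos _), ← Real.exp_add, Real.exp_le_exp]
  -- This dominates the integrand by `exp ε` times a Gaussian.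
  have h : x ^ 2 - 1 ≤ x ^ d := by
    obtain ⟨m, rfl⟩ := hd
    have hm : m ≠ 0 := by omega
    rw [← two_mul, pow_mul]
    rcases le_total 1 (x ^ 2) with h1 | h1
    · have := le_self_pow₀ h1 hm
      linarith
    · have : 0 ≤ (x ^ 2) ^ m := by positivity
      linarith
  nlinarith

theorem objective_sum_pow_lt_top (hd : Even d) (hd0 : 0 < d) {ε : ℝ} (hε : 0 < ε) :
    objective (ε • ∑ i : Fin n, (X i : MvPolynomial (Fin n) ℝ) ^ d) < ∞ := by
  have h : Integrable fun x : Fin n → ℝ => ∏ i, Real.exp (-(ε * x i ^ d)) :=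
    Integrable.fintype_prod fun _ => integrable_exp_neg_mul_even_pow hd hd0 hε
  refine lt_of_eq_of_lt (lintegral_congr fun x => ?_) h.lintegral_lt_top
  rw [← Real.exp_sum]
  simp [smul_eval, Finset.mul_sum]

theorem isHomogeneous_sum_pow (ε : ℝ) :
    (ε • ∑ i : Fin n, (X i : MvPolynomial (Fin n) ℝ) ^ d).IsHomogeneous d := by
  rw [smul_eq_C_mul]
  refine IsHomogeneous.C_mul (IsHomogeneous.sum _ _ _ fun i _ => ?_) ε
  simpa using (isHomogeneous_X ℝ i).pow d

/-- The objective has exactly one minimizer over a set of forms that is closed, relatively compact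
and midpoint convex as far as its elements of finite objective are concerned. -/
theorem exists_isUniqueOptimal {S T : Set (MvPolynomial (Fin n) ℝ)} (hT : IsCompact T)
    (hhom : ∀ g ∈ S, g.IsHomogeneous d) (hST : ∀ g ∈ S, objective g < ∞ → g ∈ T)
    (hclosed : ∀ (p : ℕ → MvPolynomial (Fin n) ℝ) (q : MvPolynomial (Fin n) ℝ),
      (∀ i, p i ∈ S) → (∀ i, objective (p i) < ∞) → Tendsto p atTop (𝓝 q) →
      objective q < ∞ → q ∈ S)
    (hmid : ∀ g ∈ S, ∀ h ∈ S, objective g < ∞ → objective h < ∞ →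
      objective ((1 / 2 : ℝ) • (g + h)) < ∞ → (1 / 2 : ℝ) • (g + h) ∈ S)
    (hfin : optimalValue S < ∞) : ∃ g, IsUniqueOptimal S g := by
  have hval : optimalValue S = sInf (objective '' S) := sInf_image.symm
  have hle : ∀ g ∈ S, optimalValue S ≤ objective g := fun g hg => iInf₂_le g hg
  have hne : (objective '' S).Nonempty := by
    by_contra! he
    rw [hval, he, sInf_empty] at hfin
    exact hfin.ne rfl
  obtain ⟨u, -, hu, huS⟩ := exists_seq_tendsto_sInf hne (OrderBot.bddBelow _)
  rw [← hval] at hu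
  obtain ⟨N, hN⟩ := eventually_atTop.1 (hu.eventually (gt_mem_nhds hfin))
  choose p hpS hpu using huS
  have hpN : ∀ i, objective (p (i + N)) < ∞ := fun i => by
    rw [hpu]; exact hN _ (by omega)
  obtain ⟨q, -, φ, hφ, hlim⟩ := hT.tendsto_subseq (x := fun i => p (i + N))
    fun i => hST _ (hpS _) (hpN i)
  have hqhom : q.IsHomogeneous d := (isClosed_isHomogeneous d).mem_of_tendsto hlim
    (Eventually.of_forall fun i => hhom _ (hpS _))
  have hobj : objective q ≤ optimalValue S := by
    refine (objective_le_liminf (fun i => (hhom _ (hpS _)).totalDegree_le)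
      hqhom.totalDegree_le hlim).trans (le_of_eq ?_)
    refine Tendsto.liminf_eq ?_
    have h1 := (hu.comp (tendsto_add_atTop_nat N)).comp hφ.tendsto_atTop
    exact h1.congr fun i => (hpu _).symm
  have hqS : q ∈ S := hclosed _ q (fun i => hpS _) (fun i => hpN _) hlim (hobj.trans_lt hfin)
  refine ⟨q, ⟨hqS, le_antisymm hobj (hle q hqS)⟩, fun h hh hhval => ?_⟩
  by_contra hne'
  have h1 := objective_midpoint_lt hne' hfin hhval.le hobj
  exact (hle _ (hmid h hh q hqS (hhval.trans_lt hfin) (hobj.trans_lt hfin)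
    (h1.trans hfin))).not_gt h1

end Objective

/-! ### The problems `P` and `P_k` -/

section Problems

variable {n d s : ℕ} {w : Fin s → MvPolynomial (Fin n) ℝ}

theorem isHomogeneous_midpoint {g h : MvPolynomial (Fin n) ℝ} (hg : g.IsHomogeneous d)
    (hh : h.IsHomogeneous d) : ((1 / 2 : ℝ) • (g + h)).IsHomogeneous d := by
  rw [smul_eq_C_mul]
  exact (hg.add hh).C_mul _

theorem sosCone_midpoint {r : ℕ} {a b : MvPolynomial (Fin n) ℝ} (ha : a ∈ sosCone n r)
    (hb : b ∈ sosCone n r) : (1 / 2 : ℝ) • (a + b) ∈ sosCone n r := by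
  refine ⟨?_, (totalDegree_smul_le _ _).trans ((totalDegree_add _ _).trans (max_le ha.2 hb.2))⟩
  rw [smul_eq_C_mul, ← Real.mul_self_sqrt (by norm_num : (0 : ℝ) ≤ 1 / 2), C_mul]
  exact (IsSumSq.mul_self _).mul (ha.1.add hb.1)

theorem truncatedModule_midpoint {k : ℕ} {a b : MvPolynomial (Fin n) ℝ}
    (ha : a ∈ truncatedModule w k) (hb : b ∈ truncatedModule w k) :
    (1 / 2 : ℝ) • (a + b) ∈ truncatedModule w k := by
  obtain ⟨σ₀, h₀, σ, hσ, rfl⟩ := ha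
  obtain ⟨τ₀, h₀', τ, hτ, rfl⟩ := hb
  refine ⟨_, sosCone_midpoint h₀ h₀', fun j => (1 / 2 : ℝ) • (σ j + τ j), fun j => ?_, ?_⟩
  · have hz : ∀ r, (0 : MvPolynomial (Fin n) ℝ) ∈ sosCone n r := fun r =>
      ⟨IsSumSq.zero, by simp⟩
    by_cases hk : halfDegree (w j) ≤ k
    · refine Or.inl ⟨hk, sosCone_midpoint ?_ ?_⟩
      · rcases hσ j with h | h
        · exact h.2
        · rw [h]; exact hz _
      · rcases hτ j with h | h
        · exact h.2
        · rw [h]; exact hz _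
    · right
      simp only
      rw [(hσ j).resolve_left fun h => hk h.1, (hτ j).resolve_left fun h => hk h.1]
      simp
  · simp only [smul_mul_assoc, add_mul, ← Finset.smul_sum, Finset.sum_add_distrib, ← smul_add]
    congr 1
    ring

theorem one_sub_midpoint (g h : MvPolynomial (Fin n) ℝ) :
    1 - (1 / 2 : ℝ) • (g + h) = (1 / 2 : ℝ) • ((1 - g) + (1 - h)) := by
  have : (1 : MvPolynomial (Fin n) ℝ) = (1 / 2 : ℝ) • (1 + 1) := by
    rw [smul_add, ← add_smul]; norm_num
  rw [show (1 - g) + (1 - h) = (1 + 1) - (g + h) by ring, smul_sub, ← this]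

theorem mem_feasible (hd : 0 < d) {K : Set (Fin n → ℝ)} {g : MvPolynomial (Fin n) ℝ}
    (hg : g.IsHomogeneous d) (hfin : objective g < ∞) (hK : ∀ x ∈ K, eval x g ≤ 1) :
    g ∈ feasible d K := by
  refine ⟨mem_finiteVolumeForms hd hg hfin, ?_, fun x hx => ?_⟩
  · refine (totalDegree_sub _ _).trans (max_le ?_ hg.totalDegree_le)
    simp
  · have := hK x hx
    simpa using this

theorem eval_le_one_of_mem_feasible {K : Set (Fin n → ℝ)} {g : MvPolynomial (Fin n) ℝ}
    (hg : g ∈ feasible d K) {x : Fin n → ℝ} (hx : x ∈ K) : eval x g ≤ 1 := by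
  have := hg.2.2 x hx
  simpa using this

theorem mem_feasible_of_mem_feasibleLevel (hd : 0 < d) {k : ℕ} {g : MvPolynomial (Fin n) ℝ}
    (hg : g ∈ feasibleLevel d w k) (hfin : objective g < ∞) :
    g ∈ feasible d (semialgebraicSet w) := by
  refine mem_feasible hd hg.1 hfin fun x hx => ?_
  have := eval_nonneg_of_mem_quadraticModule (truncatedModule_subset k hg.2) hx
  simpa using this

theorem optimalValue_feasible_le (hd : 0 < d) (k : ℕ) :
    optimalValue (feasible d (semialgebraicSet w)) ≤ optimalValue (feasibleLevel d w k) := by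
  refine le_iInf₂ fun g hg => ?_
  -- Members of infinite objective may lie outside `feasible`, but they do not affect the infimum.
  by_cases hfin : objective g < ∞
  · exact iInf₂_le g (mem_feasible_of_mem_feasibleLevel hd hg hfin)
  · rw [not_lt_top_iff.1 hfin]
    exact le_top

theorem optimalValue_feasible_lt_top (hd : Even d) (hd0 : 0 < d) {K : Set (Fin n → ℝ)}
    (hK : IsCompact K) : optimalValue (feasible d K) < ∞ := by
  obtain ⟨M, hM⟩ := (hK.image (MvPolynomial.continuous_eval
    (∑ i : Fin n, (X i : MvPolynomial (Fin n) ℝ) ^ d))).bddAbove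
  have hM' : ∀ x ∈ K, eval x (∑ i : Fin n, (X i : MvPolynomial (Fin n) ℝ) ^ d) ≤ max M 1 :=
    fun x hx => (hM ⟨x, hx, rfl⟩).trans (le_max_left _ _)
  have hpos : 0 < max M 1 := lt_max_of_lt_right one_pos
  have hfin := objective_sum_pow_lt_top (n := n) hd hd0 (inv_pos.2 hpos)
  refine lt_of_le_of_lt (iInf₂_le _ (mem_feasible hd0 (isHomogeneous_sum_pow _) hfin
    fun x hx => ?_)) hfin
  rw [smul_eval, inv_mul_le_iff₀ hpos, mul_one]
  exact hM' x hx

theorem tendsto_one_sub {p : ℕ → MvPolynomial (Fin n) ℝ} {q : MvPolynomial (Fin n) ℝ}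
    (h : Tendsto p atTop (𝓝 q)) : Tendsto (fun i => 1 - p i) atTop (𝓝 (1 - q)) := by
  refine tendsto_iff_coeff.2 fun α => ?_
  simp only [coeff_sub]
  exact tendsto_const_nhds.sub (tendsto_iff_coeff.1 h α)

theorem exists_isCompact_feasible (hint : (interior (semialgebraicSet w)).Nonempty) :
    ∃ T : Set (MvPolynomial (Fin n) ℝ), IsCompact T ∧ (∀ g ∈ T, g.IsHomogeneous d) ∧
      feasible d (semialgebraicSet w) ⊆ T := by
  obtain ⟨P, hPU, hP⟩ := exists_isDetermining isOpen_interior hint d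
  obtain ⟨T, hT, hThom, hTmem⟩ := exists_isCompact_forms hP
  exact ⟨T, hT, hThom, fun g hg => hTmem g hg.1.1 fun x hx =>
    ⟨hg.1.2.1 x, eval_le_one_of_mem_feasible hg (interior_subset (hPU hx))⟩⟩

theorem feasible_closed (hd : 0 < d) {K : Set (Fin n → ℝ)} {p : ℕ → MvPolynomial (Fin n) ℝ}
    {q : MvPolynomial (Fin n) ℝ} (hp : ∀ i, p i ∈ feasible d K) (h : Tendsto p atTop (𝓝 q))
    (hq : objective q < ∞) : q ∈ feasible d K := by
  have hqhom : q.IsHomogeneous d := (isClosed_isHomogeneous d).mem_of_tendsto h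
    (Eventually.of_forall fun i => (hp i).1.1)
  exact mem_feasible hd hqhom hq fun x hx => le_of_tendsto
    (tendsto_eval (fun i => (hp i).1.1.totalDegree_le) hqhom.totalDegree_le h x)
    (Eventually.of_forall fun i => eval_le_one_of_mem_feasible (hp i) hx)

theorem exists_isUniqueOptimal_feasible (hd : Even d) (hd0 : 0 < d)
    (hK : IsCompact (semialgebraicSet w)) (hint : (interior (semialgebraicSet w)).Nonempty) :
    ∃ g, IsUniqueOptimal (feasible d (semialgebraicSet w)) g := by
  obtain ⟨T, hT, -, hST⟩ := exists_isCompact_feasible (d := d) hint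
  refine exists_isUniqueOptimal (d := d) hT (fun g hg => hg.1.1) (fun g hg _ => hST hg)
    (fun p q hp _ h hq => feasible_closed hd0 hp h hq) (fun g hg h hh _ _ hfin => ?_)
    (optimalValue_feasible_lt_top hd hd0 hK)
  refine mem_feasible hd0 (isHomogeneous_midpoint hg.1.1 hh.1.1) hfin fun x hx => ?_
  rw [smul_eval, map_add]
  linarith [eval_le_one_of_mem_feasible hg hx, eval_le_one_of_mem_feasible hh hx]

/-- In a set with nonempty interior that satisfies `w j ≥ 0`, there is a nonempty open subset on
which all nonzero `w j` are positive. -/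
theorem exists_isOpen_forall_pos (hint : (interior (semialgebraicSet w)).Nonempty) :
    ∃ U : Set (Fin n → ℝ), IsOpen U ∧ U.Nonempty ∧ U ⊆ semialgebraicSet w ∧
      ∀ x ∈ U, ∀ j, w j ≠ 0 → 0 < eval x (w j) := by
  classical
  let f : MvPolynomial (Fin n) ℝ := ∏ j, if w j = 0 then 1 else w j
  have hf : f ≠ 0 := Finset.prod_ne_zero_iff.2 fun j _ => by
    split_ifs with h
    · exact one_ne_zero
    · exact h
  obtain ⟨x, hx, hxf⟩ := exists_eval_ne_zero isOpen_interior hint hf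
  refine ⟨interior (semialgebraicSet w) ∩ {y | eval y f ≠ 0},
    isOpen_interior.inter (isOpen_ne_fun (MvPolynomial.continuous_eval f) continuous_const),
    ⟨x, hx, hxf⟩, fun y hy => interior_subset hy.1, fun y hy j hj => ?_⟩
  refine lt_of_le_of_ne (interior_subset hy.1 j) fun h => hy.2 ?_
  rw [map_prod]
  exact Finset.prod_eq_zero (Finset.mem_univ j) (by rw [if_neg hj]; exact h.symm)

/-- Finite objective gives `p i ≥ 0`, so the values of `1 - p i` on `P` sum to at most `P.card` and
all `1 - p i` lie in one compact piece of the truncated module. -/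
theorem feasibleLevel_closed (hd : 0 < d) (hint : (interior (semialgebraicSet w)).Nonempty)
    {k : ℕ} {p : ℕ → MvPolynomial (Fin n) ℝ} {q : MvPolynomial (Fin n) ℝ}
    (hp : ∀ i, p i ∈ feasibleLevel d w k) (hfin : ∀ i, objective (p i) < ∞)
    (h : Tendsto p atTop (𝓝 q)) : q ∈ feasibleLevel d w k := by
  obtain ⟨U, hU, hne, -, hpos⟩ := exists_isOpen_forall_pos hint
  obtain ⟨P, hPU, hP⟩ := exists_isDetermining hU hne k
  obtain ⟨T, hT, hTsub, hTmem⟩ := exists_isCompact_truncatedModule hP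
    (fun x hx => hpos x (hPU hx)) P.card
  refine ⟨(isClosed_isHomogeneous d).mem_of_tendsto h (Eventually.of_forall fun i => (hp i).1),
    hTsub (hT.isClosed.mem_of_tendsto (tendsto_one_sub h) (Eventually.of_forall fun i => ?_))⟩
  refine hTmem _ (hp i).2 ?_
  calc ∑ x ∈ P, eval x (1 - p i) ≤ ∑ x ∈ P, (1 : ℝ) := Finset.sum_le_sum fun x _ => by
        have := nonneg_of_objective_lt_top hd (hp i).1 (hfin i) x
        simpa using this
    _ = P.card := by simp

theorem exists_isUniqueOptimal_feasibleLevel (hd : 0 < d)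
    (hint : (interior (semialgebraicSet w)).Nonempty) {k : ℕ}
    (hfin : optimalValue (feasibleLevel d w k) < ∞) :
    ∃ g, IsUniqueOptimal (feasibleLevel d w k) g := by
  obtain ⟨T, hT, -, hST⟩ := exists_isCompact_feasible (d := d) hint
  refine exists_isUniqueOptimal (d := d) hT (fun g hg => hg.1)
    (fun g hg hgfin => hST (mem_feasible_of_mem_feasibleLevel hd hg hgfin))
    (fun p q hp hpfin h _ => feasibleLevel_closed hd hint hp hpfin h)
    (fun g hg h hh _ _ _ => ⟨isHomogeneous_midpoint hg.1 hh.1, ?_⟩) hfin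
  rw [one_sub_midpoint]
  exact truncatedModule_midpoint hg.2 hh.2

/-- Putinar's theorem needs strict positivity on `K`; the factor `t ^ d < 1` turns `g ≤ 1` into a
strict inequality. -/
theorem eventually_smul_mem_feasibleLevel (hd : 0 < d) (harch : Archimedean w)
    {g : MvPolynomial (Fin n) ℝ} (hg : g ∈ feasible d (semialgebraicSet w)) {t : ℝ} (ht : 0 < t)
    (ht1 : t < 1) : ∀ᶠ k in atTop, t ^ d • g ∈ feasibleLevel d w k := by
  have htd : t ^ d < 1 := pow_lt_one₀ ht.le ht1 hd.ne'
  have htd0 : 0 < t ^ d := by positivity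
  obtain ⟨k₁, hk₁⟩ := exists_mem_truncatedModule_of_pos harch (f := 1 - t ^ d • g) fun x hx => by
    have := eval_le_one_of_mem_feasible hg hx
    rw [map_sub, map_one, smul_eval]
    nlinarith
  filter_upwards [eventually_ge_atTop k₁] with k hk
  refine ⟨?_, truncatedModule_mono hk hk₁⟩
  rw [smul_eq_C_mul]
  exact hg.1.1.C_mul _

theorem tendsto_optimalValue (hd : 0 < d) (harch : Archimedean w) {g : MvPolynomial (Fin n) ℝ}
    (hg : IsUniqueOptimal (feasible d (semialgebraicSet w)) g)
    (hfin : optimalValue (feasible d (semialgebraicSet w)) < ∞) :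
    Tendsto (fun k : ℕ => optimalValue (feasibleLevel d w k)) atTop
      (𝓝 (optimalValue (feasible d (semialgebraicSet w)))) := by
  set ρ := optimalValue (feasible d (semialgebraicSet w)) with hρ
  refine tendsto_order.2 ⟨fun a ha => Eventually.of_forall fun k =>
    ha.trans_le (optimalValue_feasible_le hd k), fun b hb => ?_⟩
  have h1 : Tendsto (fun t : ℝ => ENNReal.ofReal (t ^ n)⁻¹ * ρ) (𝓝[<] 1) (𝓝 ρ) := by
    have h2 : Tendsto (fun t : ℝ => ENNReal.ofReal (t ^ n)⁻¹) (𝓝[<] 1) (𝓝 1) := by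
      have h3 : ContinuousAt (fun t : ℝ => (t ^ n)⁻¹) 1 :=
        (continuous_pow n).continuousAt.inv₀ (by simp)
      have h4 := (ENNReal.continuous_ofReal.tendsto _).comp (h3.tendsto.mono_left
        (nhdsWithin_le_nhds (s := Set.Iio (1 : ℝ))))
      simp only [one_pow, inv_one, ENNReal.ofReal_one] at h4
      exact h4
    simpa using ENNReal.Tendsto.mul_const h2 (Or.inr hfin.ne)
  have hI : Set.Ioo (0 : ℝ) 1 ∈ 𝓝[<] (1 : ℝ) := Ioo_mem_nhdsLT one_pos
  obtain ⟨t, htb, ht⟩ := ((h1.eventually (gt_mem_nhds hb)).and hI).exists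
  filter_upwards [eventually_smul_mem_feasibleLevel hd harch hg.1.1 ht.1 ht.2] with k hk
  refine lt_of_le_of_lt (iInf₂_le _ hk) ?_
  rw [objective_smul hg.1.1.1.1 ht.1, hg.1.2]
  exact htb

/-- Every subsequence has a further one converging by compactness; Fatou makes its limit optimal, so
uniqueness identifies it with `g`. -/
theorem tendsto_of_isUniqueOptimal (hd : 0 < d)
    (hint : (interior (semialgebraicSet w)).Nonempty) {g : MvPolynomial (Fin n) ℝ}
    (hg : IsUniqueOptimal (feasible d (semialgebraicSet w)) g)
    (hfin : optimalValue (feasible d (semialgebraicSet w)) < ∞)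
    {p : ℕ → MvPolynomial (Fin n) ℝ} (hp : ∀ k, p k ∈ feasible d (semialgebraicSet w))
    (hlim : Tendsto (fun k => objective (p k)) atTop
      (𝓝 (optimalValue (feasible d (semialgebraicSet w))))) : Tendsto p atTop (𝓝 g) := by
  obtain ⟨T, hT, hThom, hST⟩ := exists_isCompact_feasible (d := d) hint
  refine tendsto_of_subseq_tendsto fun u hu => ?_
  obtain ⟨q, hq, φ, hφ, hφlim⟩ := hT.tendsto_subseq fun i => hST (hp (u i))
  have hobj : objective q ≤ optimalValue (feasible d (semialgebraicSet w)) :=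
    (objective_le_liminf (fun i => (hp _).1.1.totalDegree_le)
      (hThom q hq).totalDegree_le hφlim).trans
      (hlim.comp (hu.comp hφ.tendsto_atTop)).liminf_eq.le
  have hqf := feasible_closed hd (fun i => hp _) hφlim (hobj.trans_lt hfin)
  have : q = g := hg.2 q hqf (le_antisymm hobj (iInf₂_le q hqf))
  exact ⟨φ, this ▸ hφlim⟩

end Problems

end LownerJohn

theorem theorem5p4 (n d s : ℕ) (hd : Even d) (hd0 : 0 < d)
    (w : Fin s → MvPolynomial (Fin n) ℝ) (K : Set (Fin n → ℝ))
    (hK : K = LownerJohn.semialgebraicSet w) (hcompact : IsCompact K)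
    (hint : (interior K).Nonempty) (harch : LownerJohn.Archimedean w) :
    LownerJohn.optimalValue (LownerJohn.feasible d K) < ∞ ∧
    Tendsto (fun k : ℕ => LownerJohn.optimalValue (LownerJohn.feasibleLevel d w k)) atTop
      (𝓝 (LownerJohn.optimalValue (LownerJohn.feasible d K))) ∧
    ∃ gstar : MvPolynomial (Fin n) ℝ,
      LownerJohn.IsUniqueOptimal (LownerJohn.feasible d K) gstar ∧
      ∃ (k₀ : ℕ) (g : ℕ → MvPolynomial (Fin n) ℝ),
        (∀ k ≥ k₀, g k ∈ LownerJohn.finiteVolumeForms n d ∧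
          LownerJohn.IsUniqueOptimal (LownerJohn.feasibleLevel d w k) (g k)) ∧
        ∀ α : Fin n →₀ ℕ, Tendsto (fun k : ℕ => (g k).coeff α) atTop (𝓝 (gstar.coeff α)) := by
  classical
  subst hK
  have hfin := LownerJohn.optimalValue_feasible_lt_top hd hd0 hcompact
  obtain ⟨gstar, hgstar⟩ := LownerJohn.exists_isUniqueOptimal_feasible hd hd0 hcompact hint
  have htend := LownerJohn.tendsto_optimalValue hd0 harch hgstar hfin
  refine ⟨hfin, htend, gstar, hgstar, ?_⟩
  obtain ⟨k₀, hk₀⟩ := eventually_atTop.1 (htend.eventually (gt_mem_nhds hfin))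
  -- Below `k₀` the sequence is filled with `gstar`, so that all its terms lie in `feasible`.
  have hex : ∀ k, ∃ g, g ∈ LownerJohn.feasible d (LownerJohn.semialgebraicSet w) ∧
      (k₀ ≤ k → LownerJohn.IsUniqueOptimal (LownerJohn.feasibleLevel d w k) g) := fun k => by
    by_cases hk : k₀ ≤ k
    · obtain ⟨g, hg⟩ := LownerJohn.exists_isUniqueOptimal_feasibleLevel hd0 hint (hk₀ k hk)
      exact ⟨g, LownerJohn.mem_feasible_of_mem_feasibleLevel hd0 hg.1.1
        (hg.1.2.trans_lt (hk₀ k hk)), fun _ => hg⟩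
    · exact ⟨gstar, hgstar.1.1, fun h => absurd h hk⟩
  choose g hgf hg using hex
  refine ⟨k₀, g, fun k hk => ⟨(hgf k).1, hg k hk⟩, LownerJohn.tendsto_iff_coeff.1
    (LownerJohn.tendsto_of_isUniqueOptimal hd0 hint hgstar hfin hgf (htend.congr' ?_))⟩
  filter_upwards [eventually_ge_atTop k₀] with k hk
  exact (hg k hk).1.2.symm
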